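/- **Automata.** A DFA $\mathscr{A}=\langle Q,\Sigma,\delta\rangle$ consists of a finite state set $Q$, a finite input alphabet $\Sigma$ and a total transition function $\delta\colon Q\times\Sigma\to Q$; write $q\cdot w$ for the state reached from $q$ by reading the word $w\in\Sigma^*$ from left to right. $\mathscr{A}$ is *completely reachable* if every non-empty $P\subseteq Q$ equals $Q\cdot w=\{q\cdot w\mid q\in Q\}$ for some word $w$. Its *transition monoid* is the monoid of all transformations $q\mapsto q\cdot w$ of $Q$, $w\in\Sigma^*$, and its *syntactic complexity* is the size of this monoid. A completely reachable automaton with $n$ states is *minimal* if its syntactic complexity is $2^n-1$ (the least value possible). Two DFAs with the same state set are *syntactically equivalent* if their transition monoids coincide. **Trees.** A tree is a finite full binary tree: every vertex is a leaf or has exactly two children, a left child (*son*, male) and a right child (*daughter*, female). $\Gamma_v$ is the subtree of $\Gamma$ rooted at $v$, and the span of $v$ is the number of leaves of $\Gamma_v$. A homomorphism of trees is a map on vertices that sends root to root and preserves the parent–child relation and the genders of non-root vertices; $\Gamma_1$ *subordinates* $\Gamma_2$ if there is a one-to-one homomorphism $\Gamma_1\to\Gamma_2$. Let $s$ and $d$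 be the son and the daughter of the same vertex. The *nephew* of $s$ is the son of $d$, and the *niece* of $d$ is the daughter of $s$ (if they exist). A tree is *respectful* if, for all such $s,d$: whenever $s$ has a nephew $t$, $\Gamma_t$ subordinates $\Gamma_s$; and whenever $d$ has a niece $t$, $\Gamma_t$ subordinates $\Gamma_d$. A *faithful interval marking* $\mu$ of $\Gamma$ assigns to each vertex $v$ an interval $v\mu=[i,j]$ of positive integers whose number of elements is the span of $v$, so that if $v\mu=[i,j]$ and $s,d$ are the son and the daughter of $v$, then $s\mu=[i,k]$ and $d\mu=[k+1,j]$ for some $i\le k<j$. Every tree has such a marking, unique up to translation. **The automaton $\mathscr{A}_\mu(\Gamma)$.** Let $\Gamma$ be a respectful tree with root $r$ and a faithful interval marking $\mu$. The states of $\mathscr{A}_\mu(\Gamma)$ are the elements of $r\mu$, and its input letters are $a_v$, one for each non-root vertex $v$. The action of the letters is defined recursively; if $r$ is a leaf, there are no letters. Otherwise let $s$ and $d$ be the son and the daughter of $r$. * If $v\ne s$ lies in $\Gamma_s$, then $a_v$ acts on $s\mu$ as in the automaton of $\Gamma_s$ (with the restricted marking) and fixes every element of $d\mu$; symmetrically if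 $v\ne d$ lies in $\Gamma_d$. * If $d$ is a leaf and $d\mu=[y,y]$, then $x\cdot a_s=y$ for all $x\in r\mu$. Otherwise let $t$ be the nephew of $s$ and $\xi\colon\Gamma_t\to\Gamma_s$ the one-to-one homomorphism. For $x\in s\mu$, let $\ell$ be the leaf of $\Gamma_t$ with $x\in(\ell\xi)\mu$ and put $x\cdot a_s=y$, where $\ell\mu=[y,y]$; for $x\in d\mu$ put $x\cdot a_s=x\cdot a_t$, where $a_t$ acts as in the automaton of $\Gamma_d$. * Symmetrically, if $s$ is a leaf and $s\mu=[y,y]$, then $x\cdot a_d=y$ for all $x\in r\mu$. Otherwise let $t$ be the niece of $d$ and $\xi\colon\Gamma_t\to\Gamma_d$ the one-to-one homomorphism. For $x\in d\mu$, let $\ell$ be the leaf of $\Gamma_t$ with $x\in(\ell\xi)\mu$ and put $x\cdot a_d=y$, where $\ell\mu=[y,y]$; for $x\in s\mu$ put $x\cdot a_d=x\cdot a_t$, where $a_t$ acts as in the automaton of $\Gamma_s$. **Theorem.** 1. For every respectful tree $\Gamma$ and every faithful interval marking $\mu$ of $\Gamma$, the automaton $\mathscr{A}_\mu(\Gamma)$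 is a minimal completely reachable automaton. 2. For every minimal completely reachable automaton $\mathscr{A}$ there are a respectful tree $\Gamma$ and a faithful interval marking $\mu$ of $\Gamma$ such that, after a suitable bijective renaming of the states of $\mathscr{A}_\mu(\Gamma)$ by the states of $\mathscr{A}$, the two automata are syntactically equivalent. 3. Every minimal completely reachable automaton with $n$ states has at least $2n-2$ input letters. -/

import Mathlib

universe u v

/-! ### Automata -/

/-- A complete deterministic finite automaton `⟨Q, S, δ⟩`: finite state set `Q`, finite input
alphabet `S`, totally defined transition function (no initial or final states). -/
structure Automaton (Q : Type u) (S : Type v) [Finite Q] [Finite S] where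
  /-- the transition function `δ : Q × S → Q` -/
  step : Q → S → Q

namespace Automaton

variable {Q : Type u} {S : Type v} [Finite Q] [Finite S]

/-- The action `q ↦ q · w` of a word; letters are read from left to right. -/
def run (A : Automaton Q S) (q : Q) (w : List S) : Q := w.foldl A.step q

/-- A subset `P` of the state set is reachable if `P = Q · w` for some word `w`. -/
def Reachable (A : Automaton Q S) (P : Set Q) : Prop :=
  ∃ w : List S, P = Set.range fun q => A.run q w

/-- Every non-empty subset of the state set is reachable. -/
def CompletelyReachable (A : Automaton Q S) : Prop :=
  ∀ P : Set Q, P.Nonempty → A.Reachable P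

/-- The transition monoid: all transformations of `Q` induced by words (a submonoid of the monoid
of all maps `Q → Q` under composition). -/
def transitionMonoid (A : Automaton Q S) : Submonoid (Function.End Q) where
  carrier := {f | ∃ w : List S, ∀ q, f q = A.run q w}
  one_mem' := ⟨[], fun _ => rfl⟩
  mul_mem' := by
    rintro f g ⟨w, hw⟩ ⟨x, hx⟩
    refine ⟨x ++ w, fun q => ?_⟩
    change f (g q) = _
    rw [hw, hx, run, run, run, List.foldl_append]

/-- The syntactic complexity: the size of the transition monoid. -/
noncomputable def syntacticComplexity (A : Automaton Q S) : ℕ := Nat.card A.transitionMonoid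

/-- A minimal completely reachable automaton: a completely reachable automaton with `n` states and
syntactic complexity `2 ^ n - 1`. -/
def IsMinimalCRA (A : Automaton Q S) : Prop :=
  A.CompletelyReachable ∧ A.syntacticComplexity = 2 ^ Nat.card Q - 1

/-- Two automata on the same state set, possibly with different input alphabets, are syntactically
equivalent if their transition monoids coincide. -/
def SyntacticallyEquivalent {T : Type*} [Finite T] (A : Automaton Q S) (B : Automaton Q T) :
    Prop :=
  A.transitionMonoid = B.transitionMonoid

/-- The isomorphic copy of an automaton with state set `R` obtained by renaming its states along a
bijection `e : Q ≃ R`. -/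
def rename {R : Type*} [Finite R] (B : Automaton R S) (e : Q ≃ R) : Automaton Q S where
  step q a := e.symm (B.step (e q) a)

end Automaton

/-! ### Full binary trees -/

/-- Full binary trees: every vertex is a leaf or has a left child (son) and a right child
(daughter). -/
inductive FullTree : Type
  | leaf : FullTree
  | node (l r : FullTree) : FullTree

namespace FullTree

/-- The number of leaves. -/
def numLeaves : FullTree → ℕ
  | leaf => 1
  | node l r => l.numLeaves + r.numLeaves

/-- The vertices of a tree: the root, the vertices of the left subtree and the vertices of the
right subtree. -/
inductive Vertex : FullTree → Type
  | root {Γ : FullTree} : Vertex Γ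
  | left {l r : FullTree} (v : Vertex l) : Vertex (node l r)
  | right {l r : FullTree} (v : Vertex r) : Vertex (node l r)

namespace Vertex

/-- `IsSon s v`: the vertex `s` is the left child (son) of `v`. -/
inductive IsSon : {Γ : FullTree} → Vertex Γ → Vertex Γ → Prop
  | root {l r : FullTree} : IsSon (left root : Vertex (node l r)) root
  | left {l r : FullTree} {s v : Vertex l} :
      IsSon s v → IsSon (left s : Vertex (node l r)) (left v)
  | right {l r : FullTree} {s v : Vertex r} :
      IsSon s v → IsSon (right s : Vertex (node l r)) (right v)

/-- `IsDaughter d v`: the vertex `d` is the right child (daughter) of `v`. -/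
inductive IsDaughter : {Γ : FullTree} → Vertex Γ → Vertex Γ → Prop
  | root {l r : FullTree} : IsDaughter (right root : Vertex (node l r)) root
  | left {l r : FullTree} {d v : Vertex l} :
      IsDaughter d v → IsDaughter (left d : Vertex (node l r)) (left v)
  | right {l r : FullTree} {d v : Vertex r} :
      IsDaughter d v → IsDaughter (right d : Vertex (node l r)) (right v)

/-- The subtree `Γ_v` rooted at the vertex `v`. -/
def subtree : {Γ : FullTree} → Vertex Γ → FullTree
  | Γ, root => Γ
  | _, left v => v.subtree
  | _, right v => v.subtree

/-- The span of `v`: the number of leaves of the subtree rooted at `v`. -/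
def span {Γ : FullTree} (v : Vertex Γ) : ℕ := v.subtree.numLeaves

/-- A vertex without children. -/
def IsLeaf {Γ : FullTree} (v : Vertex Γ) : Prop := v.subtree = leaf

end Vertex

open Vertex

/-- Homomorphisms of trees: maps on vertices that send the root to the root and preserve the
parent–child relation and the genders of non-root vertices. -/
structure IsHom {Γ₁ Γ₂ : FullTree} (ξ : Vertex Γ₁ → Vertex Γ₂) : Prop where
  map_root : ξ root = root
  map_son : ∀ s v, IsSon s v → IsSon (ξ s) (ξ v)
  map_daughter : ∀ d v, IsDaughter d v → IsDaughter (ξ d) (ξ v)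

/-- `Γ₁` subordinates `Γ₂` if there is a one-to-one homomorphism from `Γ₁` to `Γ₂`. -/
def Subordinates (Γ₁ Γ₂ : FullTree) : Prop :=
  ∃ ξ : Vertex Γ₁ → Vertex Γ₂, IsHom ξ ∧ Function.Injective ξ

/-- Respectful trees. Here `s` and `d` are the son and the daughter of the same vertex `p`. -/
structure Respectful (Γ : FullTree) : Prop where
  /-- The nephew `t` of a male vertex `s` (the son of his sister `d`) subordinates `s`. -/
  nephew : ∀ p s d t : Vertex Γ, IsSon s p → IsDaughter d p → IsSon t d →
    Subordinates t.subtree s.subtree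
  /-- The niece `t` of a female vertex `d` (the daughter of her brother `s`) subordinates `d`. -/
  niece : ∀ p s d t : Vertex Γ, IsSon s p → IsDaughter d p → IsDaughter t s →
    Subordinates t.subtree d.subtree

/-! ### Faithful interval markings -/

/-- Faithful interval markings of a tree by intervals `[i, j]` of positive integers. -/
structure IsFaithful {Γ : FullTree} (μ : Vertex Γ → NonemptyInterval ℕ) : Prop where
  pos : ∀ v, 1 ≤ (μ v).fst
  card : ∀ v, (Finset.Icc (μ v).fst (μ v).snd).card = v.span
  split : ∀ v s d, IsSon s v → IsDaughter d v →
    ∃ k, (μ v).fst ≤ k ∧ k < (μ v).snd ∧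
      (μ s).fst = (μ v).fst ∧ (μ s).snd = k ∧ (μ d).fst = k + 1 ∧ (μ d).snd = (μ v).snd

/-! ### The construction of an automaton from a marked tree -/

/-- Let `Γ₁` subordinate `Γ₂` and let both trees be marked. This sends a number `x` in the interval
of the root of `Γ₂` to the number `y` such that, for a one-to-one homomorphism `ξ : Γ₁ → Γ₂` and
some leaf `ℓ` of `Γ₁`, the number `x` lies in the interval of `ξ ℓ` and the interval of `ℓ` is
`[y]`. -/
noncomputable def transfer {Γ₁ Γ₂ : FullTree} (μ₁ : Vertex Γ₁ → NonemptyInterval ℕ)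
    (μ₂ : Vertex Γ₂ → NonemptyInterval ℕ) (x : ℕ) : ℕ :=
  Classical.epsilon fun y => ∃ ξ : Vertex Γ₁ → Vertex Γ₂, IsHom ξ ∧ Function.Injective ξ ∧
    ∃ ℓ : Vertex Γ₁, ℓ.IsLeaf ∧ x ∈ μ₂ (ξ ℓ) ∧ μ₁ ℓ = NonemptyInterval.pure y

open Classical in
/-- The action `x ↦ x · a_v` of the letter `a_v` on the numbers `x` in the interval of the root
of `Γ`, by recursion on the tree. The root has no letter: the value at `v = root` is a dummy. -/
noncomputable def act : (Γ : FullTree) → (Vertex Γ → NonemptyInterval ℕ) → Vertex Γ → ℕ → ℕ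
  | _, _, root, x => x
  -- `v` is the son of the root and has no nephew
  | node _ leaf, μ, left root, _ => (μ (right root)).fst
  -- `v` is the son of the root and has the nephew `right (left root)`
  | node _ (node t t'), μ, left root, x =>
      if x ∈ μ (left root) then
        transfer (fun w : Vertex t => μ (right (left w))) (fun w => μ (left w)) x
      else act (node t t') (fun w => μ (right w)) (left root) x
  -- `v` is a non-root vertex of the left subtree
  | node l _, μ, left v, x =>
      if x ∈ μ (left root) then act l (fun w => μ (left w)) v x else x
  -- `v` is the daughter of the root and has no niece
  | node leaf _, μ, right root, _ => (μ (left root)).fst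
  -- `v` is the daughter of the root and has the niece `left (right root)`
  | node (node t' t) _, μ, right root, x =>
      if x ∈ μ (right root) then
        transfer (fun w : Vertex t => μ (left (right w))) (fun w => μ (right w)) x
      else act (node t' t) (fun w => μ (left w)) (right root) x
  -- `v` is a non-root vertex of the right subtree
  | node _ r, μ, right v, x =>
      if x ∈ μ (right root) then act r (fun w => μ (right w)) v x else x

/-! ### Helper facts: the construction is well defined -/

instance finite_vertex (Γ : FullTree) : Finite (Vertex Γ) := by
  induction Γ with
  | leaf =>
    have : Subsingleton (Vertex leaf) := ⟨by rintro ⟨⟩ ⟨⟩; rfl⟩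
    infer_instance
  | node l r hl hr =>
    refine Finite.of_surjective
      (fun x : Option (Vertex l ⊕ Vertex r) => match x with
        | none => root
        | some (Sum.inl v) => left v
        | some (Sum.inr v) => right v) ?_
    rintro (_ | v | v)
    · exact ⟨none, rfl⟩
    · exact ⟨some (Sum.inl v), rfl⟩
    · exact ⟨some (Sum.inr v), rfl⟩

theorem Respectful.left {l r : FullTree} (h : Respectful (node l r)) : Respectful l :=
  ⟨fun p s d t h₁ h₂ h₃ => h.nephew (.left p) (.left s) (.left d) (.left t) (.left h₁) (.left h₂)
    (.left h₃), fun p s d t h₁ h₂ h₃ => h.niece (.left p) (.left s) (.left d) (.left t) (.left h₁)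
    (.left h₂) (.left h₃)⟩

theorem Respectful.right {l r : FullTree} (h : Respectful (node l r)) : Respectful r :=
  ⟨fun p s d t h₁ h₂ h₃ => h.nephew (.right p) (.right s) (.right d) (.right t) (.right h₁)
    (.right h₂) (.right h₃), fun p s d t h₁ h₂ h₃ => h.niece (.right p) (.right s) (.right d)
    (.right t) (.right h₁) (.right h₂) (.right h₃)⟩

theorem IsFaithful.left {l r : FullTree} {μ : Vertex (node l r) → NonemptyInterval ℕ}
    (h : IsFaithful μ) : IsFaithful fun w : Vertex l => μ (.left w) :=
  ⟨fun v => h.pos (.left v), fun v => h.card (.left v),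
    fun v s d h₁ h₂ => h.split (.left v) (.left s) (.left d) (.left h₁) (.left h₂)⟩

theorem IsFaithful.right {l r : FullTree} {μ : Vertex (node l r) → NonemptyInterval ℕ}
    (h : IsFaithful μ) : IsFaithful fun w : Vertex r => μ (.right w) :=
  ⟨fun v => h.pos (.right v), fun v => h.card (.right v),
    fun v s d h₁ h₂ => h.split (.right v) (.right s) (.right d) (.right h₁) (.right h₂)⟩

theorem IsFaithful.mem_root {l r : FullTree} {μ : Vertex (node l r) → NonemptyInterval ℕ}
    (h : IsFaithful μ) (x : ℕ) :
    x ∈ μ root ↔ x ∈ μ (.left root) ∨ x ∈ μ (.right root) := by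
  obtain ⟨k, h₁, h₂, h₃, h₄, h₅, h₆⟩ := h.split root (.left root) (.right root) .root .root
  simp only [NonemptyInterval.mem_def]
  omega

theorem IsFaithful.mem_root_of_mem {Γ : FullTree} {μ : Vertex Γ → NonemptyInterval ℕ}
    (h : IsFaithful μ) (v : Vertex Γ) {x : ℕ} (hx : x ∈ μ v) : x ∈ μ root := by
  induction v with
  | root => exact hx
  | left v ih => exact (h.mem_root x).2 (Or.inl (ih h.left hx))
  | right v ih => exact (h.mem_root x).2 (Or.inr (ih h.right hx))

theorem IsFaithful.eq_pure {Γ : FullTree} {μ : Vertex Γ → NonemptyInterval ℕ}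
    (h : IsFaithful μ) {v : Vertex Γ} (hv : v.IsLeaf) : ∃ y, μ v = NonemptyInterval.pure y := by
  have hc := h.card v
  rw [span, hv, numLeaves, Nat.card_Icc] at hc
  have hle := (μ v).fst_le_snd
  refine ⟨(μ v).fst, ?_⟩
  apply NonemptyInterval.ext
  apply Prod.ext
  · rfl
  · change (μ v).snd = (μ v).fst
    omega

/-- The intervals of the images of the leaves of `Γ₁` cover the interval of the root of `Γ₂`. -/
theorem IsHom.exists_leaf {Γ₁ Γ₂ : FullTree} {ξ : Vertex Γ₁ → Vertex Γ₂} (hξ : IsHom ξ)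
    {μ : Vertex Γ₂ → NonemptyInterval ℕ} (hμ : IsFaithful μ) {x : ℕ} (hx : x ∈ μ root) :
    ∃ ℓ : Vertex Γ₁, ℓ.IsLeaf ∧ x ∈ μ (ξ ℓ) := by
  suffices H : ∀ (Γ : FullTree) (f : Vertex Γ → Vertex Γ₂),
      (∀ s v, IsSon s v → IsSon (f s) (f v)) → (∀ d v, IsDaughter d v → IsDaughter (f d) (f v)) →
      x ∈ μ (f root) → ∃ ℓ : Vertex Γ, ℓ.IsLeaf ∧ x ∈ μ (f ℓ) from
    H Γ₁ ξ hξ.map_son hξ.map_daughter (by rwa [hξ.map_root])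
  intro Γ
  induction Γ with
  | leaf => exact fun f _ _ hx => ⟨root, rfl, hx⟩
  | node l r hl hr =>
    intro f hs hd hx
    obtain ⟨k, h₁, h₂, h₃, h₄, h₅, h₆⟩ := hμ.split _ _ _ (hs (.left root) root .root)
      (hd (.right root) root .root)
    rw [NonemptyInterval.mem_def] at hx
    rcases le_or_gt x k with hk | hk
    · obtain ⟨ℓ, h, h'⟩ := hl (fun w => f (.left w)) (fun s v h => hs _ _ (.left h))
        (fun s v h => hd _ _ (.left h)) (by rw [NonemptyInterval.mem_def]; omega)
      exact ⟨.left ℓ, h, h'⟩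
    · obtain ⟨ℓ, h, h'⟩ := hr (fun w => f (.right w)) (fun s v h => hs _ _ (.right h))
        (fun s v h => hd _ _ (.right h)) (by rw [NonemptyInterval.mem_def]; omega)
      exact ⟨.right ℓ, h, h'⟩

theorem transfer_mem {Γ₁ Γ₂ : FullTree} {μ₁ : Vertex Γ₁ → NonemptyInterval ℕ}
    {μ₂ : Vertex Γ₂ → NonemptyInterval ℕ} (h : Subordinates Γ₁ Γ₂) (h₁ : IsFaithful μ₁)
    (h₂ : IsFaithful μ₂) {x : ℕ} (hx : x ∈ μ₂ root) : transfer μ₁ μ₂ x ∈ μ₁ root := by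
  obtain ⟨ξ, hξ, hinj⟩ := h
  obtain ⟨ℓ, hℓ, hxℓ⟩ := hξ.exists_leaf h₂ hx
  obtain ⟨y, hy⟩ := h₁.eq_pure hℓ
  obtain ⟨_, -, -, ℓ', -, -, h'⟩ := Classical.epsilon_spec
    (p := fun y => ∃ ξ : Vertex Γ₁ → Vertex Γ₂, IsHom ξ ∧ Function.Injective ξ ∧
      ∃ ℓ : Vertex Γ₁, ℓ.IsLeaf ∧ x ∈ μ₂ (ξ ℓ) ∧ μ₁ ℓ = NonemptyInterval.pure y)
    ⟨y, ξ, hξ, hinj, ℓ, hℓ, hxℓ, hy⟩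
  refine h₁.mem_root_of_mem ℓ' ?_
  rw [h']
  exact NonemptyInterval.mem_pure.2 rfl

/-- Every letter maps the interval of the root into itself. -/
theorem act_mem {Γ : FullTree} {μ : Vertex Γ → NonemptyInterval ℕ} (hΓ : Respectful Γ)
    (hμ : IsFaithful μ) (v : Vertex Γ) {x : ℕ} (hx : x ∈ μ root) : act Γ μ v x ∈ μ root := by
  induction Γ generalizing x with
  | leaf => cases v; exact hx
  | node l r hl hr =>
    have hfst : ∀ I : NonemptyInterval ℕ, I.fst ∈ I := fun I =>
      NonemptyInterval.mem_def.2 ⟨le_rfl, I.fst_le_snd⟩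
    have hxs := (hμ.mem_root x).1 hx
    rw [hμ.mem_root]
    rcases v with _ | v | v
    · exact hxs
    · rcases v with _ | v | v
      · cases r with
        | leaf => exact Or.inr (hfst _)
        | node t t' =>
          rw [act]
          right
          split_ifs with h
          · exact hμ.right.mem_root_of_mem (.left root) (transfer_mem
              (hΓ.nephew root (.left root) (.right root) (.right (.left root)) .root .root
                (.right .root)) hμ.right.left hμ.left h)
          · exact hr hΓ.right hμ.right _ (hxs.resolve_left h)
      all_goals
        rw [act]
        split_ifs with h
        · exact Or.inl (hl hΓ.left hμ.left _ h)
        · exact Or.inr (hxs.resolve_left h)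
        all_goals exact nofun
    · rcases v with _ | v | v
      · cases l with
        | leaf => exact Or.inl (hfst _)
        | node t' t =>
          rw [act]
          left
          split_ifs with h
          · exact hμ.left.mem_root_of_mem (.right root) (transfer_mem
              (hΓ.niece root (.left root) (.right root) (.left (.right root)) .root .root
                (.left .root)) hμ.left.right hμ.right h)
          · exact hl hΓ.left hμ.left _ (hxs.resolve_right h)
      all_goals
        rw [act]
        split_ifs with h
        · exact Or.inr (hr hΓ.right hμ.right _ h)
        · exact Or.inl (hxs.resolve_right h)
        all_goals exact nofun

/-- The faithful interval marking in which the interval of the root starts with `i`. -/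
def marking : (Γ : FullTree) → ℕ → Vertex Γ → NonemptyInterval ℕ
  | Γ, i, root => ⟨(i, i + (Γ.numLeaves - 1)), Nat.le_add_right _ _⟩
  | node l _, i, left v => marking l i v
  | node l r, i, right v => marking r (i + l.numLeaves) v

theorem numLeaves_pos (Γ : FullTree) : 1 ≤ Γ.numLeaves := by
  induction Γ with
  | leaf => exact le_rfl
  | node l r hl hr => rw [numLeaves]; omega

/-- Every tree admits a faithful interval marking. -/
theorem isFaithful_marking (Γ : FullTree) {i : ℕ} (hi : 1 ≤ i) : IsFaithful (marking Γ i) := by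
  have hroot : ∀ (Γ : FullTree) (i : ℕ), marking Γ i root =
      ⟨(i, i + (Γ.numLeaves - 1)), Nat.le_add_right _ _⟩ := fun Γ i => by
    cases Γ <;> rfl
  induction Γ generalizing i with
  | leaf =>
    refine ⟨?_, ?_, ?_⟩
    · rintro ⟨⟩; exact hi
    · rintro ⟨⟩; rw [hroot]; simp [span, subtree, numLeaves]
    · rintro v s d ⟨⟩
  | node l r hl hr =>
    have h₁ := numLeaves_pos l
    have h₂ := numLeaves_pos r
    have hl' := hl hi
    have hr' := hr (i := i + l.numLeaves) (by omega)
    refine ⟨?_, ?_, ?_⟩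
    · rintro (_ | v | v)
      · exact hi
      · exact hl'.pos v
      · exact hr'.pos v
    · rintro (_ | v | v)
      · rw [hroot, Nat.card_Icc]
        simp only [span, subtree, numLeaves]
        omega
      · exact hl'.card v
      · exact hr'.card v
    · rintro v s d hs hd
      rcases hs with _ | hs | hs
      · rcases hd with _ | hd | hd
        refine ⟨i + l.numLeaves - 1, ?_⟩
        simp only [marking, numLeaves, true_and]
        omega
      · rcases hd with _ | hd | hd
        exact hl'.split _ _ _ hs hd
      · rcases hd with _ | hd | hd
        exact hr'.split _ _ _ hs hd

/-! ### The automaton of a respectful tree -/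

/-- The states: the elements of the interval of the root. -/
abbrev State {Γ : FullTree} (μ : Vertex Γ → NonemptyInterval ℕ) : Type := {x : ℕ // x ∈ μ root}

instance finite_state {Γ : FullTree} (μ : Vertex Γ → NonemptyInterval ℕ) : Finite (State μ) :=
  Set.Finite.to_subtype ((Set.finite_Icc (μ root).fst (μ root).snd).subset fun _ hx =>
    NonemptyInterval.mem_def.1 hx)

/-- The input letters `a_v`: one for each non-root vertex `v`. -/
abbrev Letter (Γ : FullTree) : Type := {v : Vertex Γ // v ≠ root}

/-- The automaton `𝒜_μ(Γ)` of a respectful tree `Γ` with a faithful interval marking `μ`. -/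
noncomputable def automaton {Γ : FullTree} (hΓ : Respectful Γ)
    {μ : Vertex Γ → NonemptyInterval ℕ} (hμ : IsFaithful μ) :
    Automaton (State μ) (Letter Γ) where
  step x a := ⟨act Γ μ a x, act_mem hΓ hμ a x.2⟩

end FullTree

/-!
A labelled tree `T` *folds* onto a labelled tree `U` by a map `f` of labels if `U` is a top part of
`T` and `f` collapses what lies below each of its leaves. Such an `f` is unique on the labels of
`T`, folds compose, and they restrict to the subtrees `T.prune P` spanned by a set `P` of leaves.
Call a map `f` *hierarchical* if it folds `T` onto the tree spanned by the image of `f`. Hierarchical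
maps form a monoid that has at most one element for each image (`Hierarchical.comp`,
`Hierarchical.eqOn`), and all three assertions compare transition monoids with it.

For a respectful tree, the letter of a vertex `v` is the hierarchical map whose image is the set of
leaves not below `v` (`FullTree.folds_act`), and words in these letters reach every non-empty set
(`FullTree.exists_actWord_image_eq`). Hence the transition monoid has exactly one element for each
non-empty set of states.

Conversely, let `M` be a monoid of transformations with exactly one element for each non-empty image.
If `f ∈ M` maps the image of `g ∈ M` onto the image of `h ∈ M`, then `f ∘ g = h`. This forces all
elements of rank two to have the same kernel `{S, D}` (`MinimalOn.exists_isSplit`), and the elements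
with an image containing `D` and meeting `S` to fix `D` pointwise; they form a smaller monoid of the
same kind on `S`. By induction there are trees for `S` and `D`, and, after passing to mirror images
if necessary, joining them at a new root gives a tree for which all elements of `M` are hierarchical
(`MinimalOn.exists_labelledTree`). The main step concerns the element `k` with image `D`: its
restriction to `S` intertwines the two smaller monoids and respects the order of the leaves, which
suffices for being a fold (`LabelledTree.folds_of_equivariant`). The tree is respectful because it
folds onto all its pruned trees, and uniqueness identifies `M` with the monoid of its automaton.

Finally, let `B` be the set of leaves below a vertex other than the root. A hierarchical map whose
image contains the complement of `B` and meets `B` fixes that complement and preserves `B`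
(`LabelledTree.Folds.block`), so a word with image `Bᶜ` contains a letter with image `Bᶜ`. There are
`2 n - 2` such sets `B`.
-/

/-! ### Labelled trees and folds -/

/-- Full binary trees whose leaves carry labels. -/
inductive LabelledTree (α : Type*) : Type _
  | leaf (x : α) : LabelledTree α
  | node (l r : LabelledTree α) : LabelledTree α

namespace LabelledTree

variable {α β γ : Type*}

/-- The set of labels of the leaves. -/
def labels : LabelledTree α → Set α
  | leaf x => {x}
  | node l r => l.labels ∪ r.labels

/-- No label occurs at two leaves. -/
def Distinct : LabelledTree α → Prop
  | leaf _ => True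
  | node l r => Disjoint l.labels r.labels ∧ l.Distinct ∧ r.Distinct

/-- The underlying unlabelled tree. -/
def shape : LabelledTree α → FullTree
  | leaf _ => FullTree.leaf
  | node l r => FullTree.node l.shape r.shape

/-- The tree with sons and daughters interchanged everywhere. -/
def mirror : LabelledTree α → LabelledTree α
  | leaf x => leaf x
  | node l r => node r.mirror l.mirror

open Classical in
/-- The tree spanned by the leaves with labels in `P`: the other leaves are removed and vertices
with a single remaining child are contracted. If `P` contains no label, the value is a dummy. -/
noncomputable def prune (P : Set α) : LabelledTree α → LabelledTree α
  | leaf x => leaf x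
  | node l r =>
    if l.labels ∩ P = ∅ then r.prune P
    else if r.labels ∩ P = ∅ then l.prune P
    else node (l.prune P) (r.prune P)

/-- `Folds f T U`: some tree `T'` with the shape of `U` is a top part of `T`, and `f` sends all
labels of `T` below a leaf of `T'` to the label of the corresponding leaf of `U`. -/
def Folds (f : α → β) : LabelledTree α → LabelledTree β → Prop
  | T, leaf y => ∀ x ∈ T.labels, f x = y
  | leaf _, node _ _ => False
  | node a b, node c d => Folds f a c ∧ Folds f b d

/-- The left-to-right order of the leaves. -/
def Before : LabelledTree α → α → α → Prop
  | leaf _, _, _ => False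
  | node l r, x, y => (x ∈ l.labels ∧ y ∈ r.labels) ∨ l.Before x y ∨ r.Before x y

theorem labels_nonempty (T : LabelledTree α) : T.labels.Nonempty := by
  induction T with
  | leaf x => exact ⟨x, rfl⟩
  | node l r hl hr => exact hl.mono Set.subset_union_left

theorem finite_labels (T : LabelledTree α) : T.labels.Finite := by
  induction T with
  | leaf x => exact Set.finite_singleton x
  | node l r hl hr => exact hl.union hr

/-! ### Pruning -/

theorem prune_congr {T : LabelledTree α} {P R : Set α} (h : T.labels ∩ P = T.labels ∩ R) :
    T.prune P = T.prune R := by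
  induction T with
  | leaf x => rfl
  | node l r hl hr =>
    have h₁ : l.labels ∩ P = l.labels ∩ R := by
      ext x; have := Set.ext_iff.1 h x; simp only [labels, Set.mem_inter_iff, Set.mem_union] at *
      tauto
    have h₂ : r.labels ∩ P = r.labels ∩ R := by
      ext x; have := Set.ext_iff.1 h x; simp only [labels, Set.mem_inter_iff, Set.mem_union] at *
      tauto
    simp only [prune, h₁, h₂, hl h₁, hr h₂]

theorem prune_node_left {l r : LabelledTree α} {P : Set α} (h : r.labels ∩ P = ∅)
    (hP : (l.labels ∩ P).Nonempty) : (node l r).prune P = l.prune P := by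
  rw [prune, if_neg hP.ne_empty, if_pos h]

theorem prune_node_right {l r : LabelledTree α} {P : Set α} (h : l.labels ∩ P = ∅) :
    (node l r).prune P = r.prune P := by
  rw [prune, if_pos h]

theorem prune_node {l r : LabelledTree α} {P : Set α} (hl : (l.labels ∩ P).Nonempty)
    (hr : (r.labels ∩ P).Nonempty) : (node l r).prune P = node (l.prune P) (r.prune P) := by
  rw [prune, if_neg hl.ne_empty, if_neg hr.ne_empty]

theorem labels_prune {T : LabelledTree α} {P : Set α} (hP : (T.labels ∩ P).Nonempty) :
    (T.prune P).labels = T.labels ∩ P := by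
  induction T with
  | leaf x =>
    obtain ⟨y, rfl, hy⟩ := hP
    simp [prune, labels, hy]
  | node l r hl hr =>
    simp only [labels, Set.union_inter_distrib_right] at hP ⊢
    rcases (l.labels ∩ P).eq_empty_or_nonempty with h | h
    · rw [h, Set.empty_union] at hP ⊢
      rw [prune_node_right h, hr hP]
    rcases (r.labels ∩ P).eq_empty_or_nonempty with h' | h'
    · rw [prune_node_left h' h, hl h, h', Set.union_empty]
    · rw [prune_node h h', labels, hl h, hr h']

theorem Distinct.prune {T : LabelledTree α} {P : Set α} (hT : T.Distinct)
    (hP : (T.labels ∩ P).Nonempty) : (T.prune P).Distinct := by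
  induction T with
  | leaf => trivial
  | node l r hl hr =>
    rw [labels, Set.union_inter_distrib_right] at hP
    rcases (l.labels ∩ P).eq_empty_or_nonempty with h | h
    · rw [h, Set.empty_union] at hP
      rw [prune_node_right h]; exact hr hT.2.2 hP
    rcases (r.labels ∩ P).eq_empty_or_nonempty with h' | h'
    · rw [prune_node_left h' h]; exact hl hT.2.1 h
    · rw [prune_node h h']
      refine ⟨?_, hl hT.2.1 h, hr hT.2.2 h'⟩
      rw [labels_prune h, labels_prune h']
      exact hT.1.mono Set.inter_subset_left Set.inter_subset_left

theorem prune_eq_self {T : LabelledTree α} {P : Set α} (h : T.labels ⊆ P) : T.prune P = T := by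
  induction T with
  | leaf x => rfl
  | node l r hl hr =>
    have h₁ : l.labels ⊆ P := Set.subset_union_left.trans h
    have h₂ : r.labels ⊆ P := Set.subset_union_right.trans h
    rw [prune_node, hl h₁, hr h₂]
    · rw [Set.inter_eq_left.2 h₁]; exact l.labels_nonempty
    · rw [Set.inter_eq_left.2 h₂]; exact r.labels_nonempty

theorem prune_prune {T : LabelledTree α} {P R : Set α} (h : R ⊆ P)
    (hR : (T.labels ∩ R).Nonempty) : (T.prune P).prune R = T.prune R := by
  induction T with
  | leaf x => rfl
  | node l r hl hr =>
    have hl' := (l.labels ∩ R).eq_empty_or_nonempty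
    have hr' := (r.labels ∩ R).eq_empty_or_nonempty
    have key : ∀ {T : LabelledTree α}, (T.labels ∩ P).Nonempty →
        (T.prune P).labels ∩ R = T.labels ∩ R := fun hT => by
      rw [labels_prune hT, Set.inter_assoc, Set.inter_eq_right.2 h]
    have mono : ∀ {T : LabelledTree α}, (T.labels ∩ R).Nonempty → (T.labels ∩ P).Nonempty :=
      fun hT => hT.mono (Set.inter_subset_inter_right _ h)
    have none : ∀ {T : LabelledTree α}, T.labels ∩ P = ∅ → T.labels ∩ R = ∅ := fun hT =>
      Set.subset_empty_iff.1 (hT ▸ Set.inter_subset_inter_right _ h)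
    have hR' : (l.labels ∩ R).Nonempty ∨ (r.labels ∩ R).Nonempty := by
      rwa [labels, Set.union_inter_distrib_right, Set.union_nonempty] at hR
    rcases (l.labels ∩ P).eq_empty_or_nonempty with h₁ | h₁
    · rw [prune_node_right h₁, prune_node_right (none h₁)]
      exact hr (hR'.resolve_left (none h₁ ▸ Set.not_nonempty_empty))
    rcases (r.labels ∩ P).eq_empty_or_nonempty with h₂ | h₂
    · have := hR'.resolve_right (none h₂ ▸ Set.not_nonempty_empty)
      rw [prune_node_left h₂ h₁, prune_node_left (none h₂) this, hl this]
    rw [prune_node h₁ h₂]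
    rcases hl' with h₃ | h₃
    · rw [prune_node_right h₃, prune_node_right (by rw [key h₁, h₃])]
      exact hr (hR'.resolve_left (h₃ ▸ Set.not_nonempty_empty))
    rcases hr' with h₄ | h₄
    · rw [prune_node_left h₄ h₃, prune_node_left (by rw [key h₂, h₄]) (by rwa [key h₁]), hl h₃]
    · rw [prune_node h₃ h₄, prune_node (by rwa [key h₁]) (by rwa [key h₂]), hl h₃, hr h₄]

theorem prune_singleton {T : LabelledTree α} {x : α} (hx : x ∈ T.labels) :
    T.Distinct → T.prune {x} = leaf x := by
  induction T with
  | leaf y => obtain rfl : x = y := hx; exact fun _ => rfl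
  | node l r hl hr =>
    rintro ⟨h, h₁, h₂⟩
    rcases hx with hx | hx
    · rw [prune_node_left _ ⟨x, hx, Set.mem_singleton x⟩, hl hx h₁]
      simpa using Set.disjoint_left.1 h hx
    · rw [prune_node_right _, hr hx h₂]
      simpa using Set.disjoint_right.1 h hx

theorem Before.mem {T : LabelledTree α} {x y : α} (h : T.Before x y) :
    x ∈ T.labels ∧ y ∈ T.labels := by
  induction T with
  | leaf => exact h.elim
  | node l r hl hr =>
    rcases h with ⟨h₁, h₂⟩ | h | h
    · exact ⟨Or.inl h₁, Or.inr h₂⟩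
    · exact ⟨Or.inl (hl h).1, Or.inl (hl h).2⟩
    · exact ⟨Or.inr (hr h).1, Or.inr (hr h).2⟩

theorem before_or_before {T : LabelledTree α} {x y : α} (hx : x ∈ T.labels) (hy : y ∈ T.labels)
    (h : x ≠ y) : T.Before x y ∨ T.Before y x := by
  induction T with
  | leaf z => exact (h (hx.trans hy.symm)).elim
  | node l r hl hr =>
    rcases hx with hx | hx <;> rcases hy with hy | hy
    · exact (hl hx hy).imp (fun h => .inr (.inl h)) (fun h => .inr (.inl h))
    · exact Or.inl (.inl ⟨hx, hy⟩)
    · exact Or.inr (.inl ⟨hy, hx⟩)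
    · exact (hr hx hy).imp (fun h => .inr (.inr h)) (fun h => .inr (.inr h))

theorem Before.ne {T : LabelledTree α} (hT : T.Distinct) {x y : α} (h : T.Before x y) : x ≠ y := by
  induction T with
  | leaf => exact h.elim
  | node l r hl hr =>
    rcases h with ⟨h₁, h₂⟩ | h | h
    · rintro rfl; exact Set.disjoint_left.1 hT.1 h₁ h₂
    · exact hl hT.2.1 h
    · exact hr hT.2.2 h

theorem Before.prune_pair {T : LabelledTree α} (hT : T.Distinct) {x y : α} (h : T.Before x y) :
    T.prune {x, y} = node (leaf x) (leaf y) := by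
  induction T with
  | leaf => exact h.elim
  | node l r hl hr =>
    obtain ⟨hd, hT₁, hT₂⟩ := hT
    rw [Set.disjoint_left] at hd
    rcases h with ⟨h₁, h₂⟩ | h | h
    · have e₁ : l.labels ∩ {x, y} = l.labels ∩ {x} := by
        ext z; simp only [Set.mem_inter_iff, Set.mem_insert_iff, Set.mem_singleton_iff]
        constructor
        · rintro ⟨hz, rfl | rfl⟩
          · exact ⟨hz, rfl⟩
          · exact (hd hz h₂).elim
        · rintro ⟨hz, rfl⟩; exact ⟨hz, Or.inl rfl⟩
      have e₂ : r.labels ∩ {x, y} = r.labels ∩ {y} := by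
        ext z; simp only [Set.mem_inter_iff, Set.mem_insert_iff, Set.mem_singleton_iff]
        constructor
        · rintro ⟨hz, rfl | rfl⟩
          · exact (hd h₁ hz).elim
          · exact ⟨hz, rfl⟩
        · rintro ⟨hz, rfl⟩; exact ⟨hz, Or.inr rfl⟩
      rw [prune_node ⟨x, h₁, by simp⟩ ⟨y, h₂, by simp⟩, prune_congr e₁, prune_congr e₂,
        prune_singleton h₁ hT₁, prune_singleton h₂ hT₂]
    · rw [prune_node_left _ ⟨x, h.mem.1, by simp⟩, hl hT₁ h]
      rw [Set.eq_empty_iff_forall_notMem]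
      rintro z ⟨hz, rfl | rfl⟩
      exacts [hd h.mem.1 hz, hd h.mem.2 hz]
    · rw [prune_node_right, hr hT₂ h]
      rw [Set.eq_empty_iff_forall_notMem]
      rintro z ⟨hz, rfl | rfl⟩
      exacts [hd hz h.mem.1, hd hz h.mem.2]

/-! ### Mirror images -/

@[simp] theorem mirror_mirror (T : LabelledTree α) : T.mirror.mirror = T := by
  induction T with
  | leaf => rfl
  | node l r hl hr => simp [mirror, hl, hr]

@[simp] theorem labels_mirror (T : LabelledTree α) : T.mirror.labels = T.labels := by
  induction T with
  | leaf => rfl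
  | node l r hl hr => simp [mirror, labels, hl, hr, Set.union_comm]

theorem Distinct.mirror {T : LabelledTree α} (h : T.Distinct) : T.mirror.Distinct := by
  induction T with
  | leaf => trivial
  | node l r hl hr =>
    exact ⟨by simpa using h.1.symm, hr h.2.2, hl h.2.1⟩

theorem prune_mirror {T : LabelledTree α} {P : Set α} (hP : (T.labels ∩ P).Nonempty) :
    T.mirror.prune P = (T.prune P).mirror := by
  induction T with
  | leaf => rfl
  | node l r hl hr =>
    rw [labels, Set.union_inter_distrib_right] at hP
    rcases (l.labels ∩ P).eq_empty_or_nonempty with h | h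
    · rw [h, Set.empty_union] at hP
      rw [prune_node_right h, mirror, prune_node_left (by simpa using h) (by simpa using hP),
        hr hP]
    rcases (r.labels ∩ P).eq_empty_or_nonempty with h' | h'
    · rw [prune_node_left h' h, mirror, prune_node_right (by simpa using h'), hl h]
    · rw [prune_node h h', mirror, prune_node (by simpa using h') (by simpa using h), hl h, hr h',
        mirror]

/-! ### Folds -/

theorem folds_leaf {f : α → β} {T : LabelledTree α} {y : β} :
    Folds f T (leaf y) ↔ ∀ x ∈ T.labels, f x = y := by
  cases T <;> rfl

theorem Folds.mirror {f : α → β} {T : LabelledTree α} {U : LabelledTree β} (h : Folds f T U) :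
    Folds f T.mirror U.mirror := by
  induction U generalizing T with
  | leaf y => exact folds_leaf.2 fun x hx => folds_leaf.1 h x (by simpa using hx)
  | node c d hc hd =>
    cases T with
    | leaf => exact h.elim
    | node a b => exact ⟨hd h.2, hc h.1⟩

theorem Folds.congr {f g : α → β} {T : LabelledTree α} {U : LabelledTree β} (h : Folds f T U)
    (hfg : Set.EqOn f g T.labels) : Folds g T U := by
  induction U generalizing T with
  | leaf y => exact folds_leaf.2 fun x hx => hfg hx ▸ folds_leaf.1 h x hx
  | node c d hc hd =>
    cases T with
    | leaf => exact h.elim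
    | node a b =>
      exact ⟨hc h.1 (hfg.mono Set.subset_union_left), hd h.2 (hfg.mono Set.subset_union_right)⟩

/-- A fold is determined by the two trees. -/
theorem Folds.eqOn {f g : α → β} {T : LabelledTree α} {U : LabelledTree β} (hf : Folds f T U)
    (hg : Folds g T U) : Set.EqOn f g T.labels := by
  induction U generalizing T with
  | leaf y => intro x hx; rw [folds_leaf.1 hf x hx, folds_leaf.1 hg x hx]
  | node c d hc hd =>
    cases T with
    | leaf => exact hf.elim
    | node a b => exact Set.eqOn_union.2 ⟨hc hf.1 hg.1, hd hf.2 hg.2⟩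

theorem Folds.image {f : α → β} {T : LabelledTree α} {U : LabelledTree β} (h : Folds f T U) :
    f '' T.labels = U.labels := by
  induction U generalizing T with
  | leaf y =>
    rw [Set.image_congr (g := fun _ => y) (folds_leaf.1 h), T.labels_nonempty.image_const, labels]
  | node c d hc hd =>
    cases T with
    | leaf => exact h.elim
    | node a b => rw [labels, Set.image_union, hc h.1, hd h.2, labels]

theorem Folds.comp {f : α → β} {g : β → γ} {T : LabelledTree α} {U : LabelledTree β}
    {V : LabelledTree γ} (hg : Folds g U V) (hf : Folds f T U) : Folds (g ∘ f) T V := by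
  induction V generalizing T U with
  | leaf z =>
    exact folds_leaf.2 fun x hx =>
      folds_leaf.1 hg _ (hf.image ▸ Set.mem_image_of_mem f hx)
  | node c d hc hd =>
    rcases U with _ | ⟨a, b⟩
    · exact hg.elim
    rcases T with _ | ⟨a', b'⟩
    · exact hf.elim
    exact ⟨hc hg.1 hf.1, hd hg.2 hf.2⟩

theorem Folds.id (T : LabelledTree α) : Folds id T T := by
  induction T with
  | leaf => exact fun x hx => hx
  | node l r hl hr => exact ⟨hl, hr⟩

theorem Folds.eqOn_id {f : α → α} {T : LabelledTree α} (h : Folds f T T) :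
    Set.EqOn f _root_.id T.labels :=
  h.eqOn (Folds.id T)

/-- The restriction of a fold to a set `P` of labels is a fold of the pruned trees. -/
theorem Folds.prune {f : α → β} {T : LabelledTree α} {U : LabelledTree β} (h : Folds f T U)
    (hU : U.Distinct) {P : Set α} (hP : P ⊆ T.labels) (hne : P.Nonempty) :
    Folds f (T.prune P) (U.prune (f '' P)) := by
  induction U generalizing T P with
  | leaf y =>
    refine folds_leaf.2 fun x hx => ?_
    rw [labels_prune (by rwa [Set.inter_eq_right.2 hP])] at hx
    exact folds_leaf.1 h x hx.1
  | node c d hc hd =>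
    rcases T with _ | ⟨a, b⟩
    · exact h.elim
    have hac : f '' (P ∩ a.labels) ⊆ c.labels :=
      h.1.image ▸ Set.image_mono Set.inter_subset_right
    have hbd : f '' (P ∩ b.labels) ⊆ d.labels :=
      h.2.image ▸ Set.image_mono Set.inter_subset_right
    have hdis := Set.disjoint_left.1 hU.1
    have hsplit : P = (P ∩ a.labels) ∪ (P ∩ b.labels) := by
      rw [← Set.inter_union_distrib_left]; exact (Set.inter_eq_left.2 hP).symm
    have ec : c.labels ∩ f '' P = c.labels ∩ f '' (P ∩ a.labels) := by
      apply Set.Subset.antisymm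
      · rintro _ ⟨hy, x, hx, rfl⟩
        rcases hP hx with hxa | hxb
        · exact ⟨hy, x, ⟨hx, hxa⟩, rfl⟩
        · exact (hdis hy (hbd ⟨x, ⟨hx, hxb⟩, rfl⟩)).elim
      · exact Set.inter_subset_inter_right _ (Set.image_mono Set.inter_subset_left)
    have ed : d.labels ∩ f '' P = d.labels ∩ f '' (P ∩ b.labels) := by
      apply Set.Subset.antisymm
      · rintro _ ⟨hy, x, hx, rfl⟩
        rcases hP hx with hxa | hxb
        · exact (hdis (hac ⟨x, ⟨hx, hxa⟩, rfl⟩) hy).elim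
        · exact ⟨hy, x, ⟨hx, hxb⟩, rfl⟩
      · exact Set.inter_subset_inter_right _ (Set.image_mono Set.inter_subset_left)
    have ea : a.labels ∩ P = a.labels ∩ (P ∩ a.labels) := by ext; simp; tauto
    have eb : b.labels ∩ P = b.labels ∩ (P ∩ b.labels) := by ext; simp; tauto
    have ha := hc (P := P ∩ a.labels) h.1 hU.2.1 Set.inter_subset_right
    have hb := hd (P := P ∩ b.labels) h.2 hU.2.2 Set.inter_subset_right
    rw [← prune_congr ec, ← prune_congr ea] at ha
    rw [← prune_congr ed, ← prune_congr eb] at hb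
    rw [Set.inter_eq_right.2 hac] at ec
    rw [Set.inter_eq_right.2 hbd] at ed
    rcases (P ∩ a.labels).eq_empty_or_nonempty with h₁ | h₁
    · have h₂ : (P ∩ b.labels).Nonempty := by rwa [hsplit, h₁, Set.empty_union] at hne
      rw [prune_node_right (by rw [Set.inter_comm, h₁]), prune_node_right (by rw [ec, h₁]; simp)]
      exact hb h₂
    rcases (P ∩ b.labels).eq_empty_or_nonempty with h₂ | h₂
    · rw [prune_node_left (by rw [Set.inter_comm, h₂]) (by rwa [Set.inter_comm]),
        prune_node_left (by rw [ed, h₂]; simp) (by rw [ec]; exact h₁.image f)]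
      exact ha h₁
    · rw [prune_node (by rwa [Set.inter_comm]) (by rwa [Set.inter_comm]),
        prune_node (by rw [ec]; exact h₁.image f) (by rw [ed]; exact h₂.image f)]
      exact ⟨ha h₁, hb h₂⟩

/-- The maps that fold `T` onto the part spanned by their image. -/
def Hierarchical (T : LabelledTree α) (f : α → α) : Prop :=
  Folds f T (T.prune (f '' T.labels))

theorem Hierarchical.comp {T : LabelledTree α} (hT : T.Distinct) {f g : α → α}
    (hg : T.Hierarchical g) (hf : T.Hierarchical f) (hfT : Set.MapsTo f T.labels T.labels)
    (hgT : Set.MapsTo g T.labels T.labels) : T.Hierarchical (g ∘ f) := by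
  have hne : (f '' T.labels).Nonempty := T.labels_nonempty.image f
  have hgne : (T.labels ∩ g '' T.labels).Nonempty := by
    rw [Set.inter_eq_right.2 hgT.image_subset]; exact T.labels_nonempty.image g
  have h := Folds.prune hg (hT.prune hgne) hfT.image_subset hne
  rw [prune_prune (Set.image_mono hfT.image_subset)] at h
  · have := h.comp hf
    rwa [← Set.image_comp] at this
  · rw [Set.inter_eq_right.2 ((Set.image_mono hfT.image_subset).trans hgT.image_subset)]
    exact hne.image g

/-- A hierarchical map is determined by its image. -/
theorem Hierarchical.eqOn {f g : α → α} {T : LabelledTree α} (hf : T.Hierarchical f)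
    (hg : T.Hierarchical g) (h : f '' T.labels = g '' T.labels) : Set.EqOn f g T.labels :=
  Folds.eqOn hf (by rw [h]; exact hg)

theorem Hierarchical.eq {T : LabelledTree α} (hTu : T.labels = Set.univ) {f g : α → α}
    (hf : T.Hierarchical f) (hg : T.Hierarchical g) (h : Set.range f = Set.range g) : f = g := by
  have := Hierarchical.eqOn hf hg (by rw [hTu, Set.image_univ, Set.image_univ, h])
  exact funext fun q => this (hTu ▸ trivial)

theorem exists_folds_of_shape_eq {T : LabelledTree α} {U : LabelledTree β} (hT : T.Distinct)
    (h : T.shape = U.shape) : ∃ f : α → β, Folds f T U := by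
  classical
  induction T generalizing U with
  | leaf x =>
    cases U with
    | leaf y => exact ⟨fun _ => y, fun _ _ => rfl⟩
    | node => cases h
  | node l r hl hr =>
    cases U with
    | leaf => cases h
    | node c d =>
      simp only [shape, FullTree.node.injEq] at h
      obtain ⟨f, hf⟩ := hl hT.2.1 h.1
      obtain ⟨g, hg⟩ := hr hT.2.2 h.2
      refine ⟨fun x => if x ∈ l.labels then f x else g x, hf.congr fun x hx => (if_pos hx).symm,
        hg.congr fun x hx => (if_neg (Set.disjoint_right.1 hT.1 hx)).symm⟩

/-! ### Equivariant maps -/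

/-- If every set of labels is the image of a fold of `T` that `φ` carries to a fold of `U`, and
`φ` does not reverse the order of leaves, then `φ` is itself a fold. -/
theorem folds_of_equivariant {T : LabelledTree α} {U : LabelledTree β} (hT : T.Distinct)
    (hU : U.Distinct) {φ : α → β} (hφ : φ '' T.labels = U.labels)
    (heq : ∀ P ⊆ T.labels, P.Nonempty → ∃ g k, Folds g T (T.prune P) ∧
      Folds k U (U.prune (φ '' P)) ∧ ∀ x ∈ T.labels, φ (g x) = k (φ x))
    (hmono : ∀ x y, T.Before x y → ¬ U.Before (φ y) (φ x)) : Folds φ T U := by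
  induction U generalizing T with
  | leaf y => exact folds_leaf.2 fun x hx => hφ.subset (Set.mem_image_of_mem φ hx)
  | node u₁ u₂ h₁ h₂ =>
    have hdis := Set.disjoint_left.1 hU.1
    obtain ⟨_, hx'⟩ := u₁.labels_nonempty
    obtain ⟨_, hy'⟩ := u₂.labels_nonempty
    obtain ⟨x, hx, rfl⟩ := hφ.superset (Or.inl hx')
    obtain ⟨y, hy, rfl⟩ := hφ.superset (Or.inr hy')
    have hxy : x ≠ y := by rintro rfl; exact hdis hx' hy'
    -- The rank-two maps `g` and `k` have the partitions at the roots of `T` and `U` as kernels, so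
    -- `φ` respects these partitions.
    have hb : T.Before x y :=
      (before_or_before hx hy hxy).resolve_right fun h => hmono _ _ h (.inl ⟨hx', hy'⟩)
    obtain ⟨g, k, hg, hk, hgk⟩ := heq {x, y} (by rintro _ (rfl | rfl) <;> assumption) ⟨x, by simp⟩
    have hb' : (node u₁ u₂).Before (φ x) (φ y) := .inl ⟨hx', hy'⟩
    rw [hb.prune_pair hT] at hg
    rw [Set.image_pair, hb'.prune_pair hU] at hk
    rcases T with _ | ⟨t₁, t₂⟩
    · exact hg.elim
    have hne : φ x ≠ φ y := fun h => hdis hx' (h ▸ hy')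
    have hmem : ∀ z ∈ t₁.labels ∪ t₂.labels, φ z ∈ u₁.labels ∪ u₂.labels := fun z hz =>
      hφ.subset (Set.mem_image_of_mem φ hz)
    have m₁ : ∀ z ∈ t₁.labels, φ z ∈ u₁.labels := fun z hz => by
      refine (hmem z (.inl hz)).resolve_right fun h => hne ?_
      rw [← folds_leaf.1 hg.1 z hz, hgk z (.inl hz), folds_leaf.1 hk.2 _ h]
    have m₂ : ∀ z ∈ t₂.labels, φ z ∈ u₂.labels := fun z hz => by
      refine (hmem z (.inr hz)).resolve_left fun h => hne ?_
      rw [← folds_leaf.1 hg.2 z hz, hgk z (.inr hz), folds_leaf.1 hk.1 _ h]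
    have s₁ : φ '' t₁.labels = u₁.labels := by
      refine (Set.image_subset_iff.2 m₁).antisymm fun w hw => ?_
      obtain ⟨z, hz | hz, rfl⟩ := hφ.superset (Or.inl hw)
      · exact ⟨z, hz, rfl⟩
      · exact (hdis hw (m₂ z hz)).elim
    have s₂ : φ '' t₂.labels = u₂.labels := by
      refine (Set.image_subset_iff.2 m₂).antisymm fun w hw => ?_
      obtain ⟨z, hz | hz, rfl⟩ := hφ.superset (Or.inr hw)
      · exact (hdis (m₁ z hz) hw).elim
      · exact ⟨z, hz, rfl⟩
    have hTdis := Set.disjoint_left.1 hT.1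
    refine ⟨h₁ hT.2.1 hU.2.1 s₁ (fun P hP hPne => ?_) (fun a b hab h => ?_),
      h₂ hT.2.2 hU.2.2 s₂ (fun P hP hPne => ?_) (fun a b hab h => ?_)⟩
    · obtain ⟨g, k, hg, hk, hgk⟩ := heq (P ∪ t₂.labels)
        (Set.union_subset_union_left _ hP) (hPne.mono Set.subset_union_left)
      have e₁ : t₁.labels ∩ (P ∪ t₂.labels) = t₁.labels ∩ P := by
        rw [Set.inter_union_distrib_left, hT.1.inter_eq, Set.union_empty]
      have e₂ : u₁.labels ∩ φ '' (P ∪ t₂.labels) = u₁.labels ∩ φ '' P := by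
        rw [Set.image_union, s₂, Set.inter_union_distrib_left, hU.1.inter_eq, Set.union_empty]
      rw [prune_node (by rw [e₁, Set.inter_eq_right.2 hP]; exact hPne)
        (by simpa [Set.inter_union_distrib_left] using .inr t₂.labels_nonempty),
        prune_congr e₁] at hg
      rw [prune_node (by
          rw [e₂, Set.inter_eq_right.2 (s₁ ▸ Set.image_mono hP)]; exact hPne.image φ)
        (by rw [Set.image_union, s₂, Set.inter_union_distrib_left, Set.inter_self]
            exact u₂.labels_nonempty.mono Set.subset_union_right), prune_congr e₂] at hk
      exact ⟨g, k, hg.1, hk.1, fun z hz => hgk z (.inl hz)⟩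
    · exact hmono a b (.inr (.inl hab)) (.inr (.inl h))
    · obtain ⟨g, k, hg, hk, hgk⟩ := heq (t₁.labels ∪ P)
        (Set.union_subset_union_right _ hP) (hPne.mono Set.subset_union_right)
      have e₁ : t₂.labels ∩ (t₁.labels ∪ P) = t₂.labels ∩ P := by
        rw [Set.inter_union_distrib_left, hT.1.symm.inter_eq, Set.empty_union]
      have e₂ : u₂.labels ∩ φ '' (t₁.labels ∪ P) = u₂.labels ∩ φ '' P := by
        rw [Set.image_union, s₁, Set.inter_union_distrib_left, hU.1.symm.inter_eq, Set.empty_union]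
      rw [prune_node
        (by simpa [Set.inter_union_distrib_left] using .inl t₁.labels_nonempty)
        (by rw [e₁, Set.inter_eq_right.2 hP]; exact hPne), prune_congr e₁] at hg
      rw [prune_node
        (by rw [Set.image_union, s₁, Set.inter_union_distrib_left, Set.inter_self]
            exact u₁.labels_nonempty.mono Set.subset_union_left)
        (by rw [e₂, Set.inter_eq_right.2 (s₂ ▸ Set.image_mono hP)]; exact hPne.image φ),
        prune_congr e₂] at hk
      exact ⟨g, k, hg.2, hk.2, fun z hz => hgk z (.inr hz)⟩
    · exact hmono a b (.inr (.inr hab)) (.inr (.inr h))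

end LabelledTree

/-! ### Monoids with one transformation for each image -/

/-- A set `M` of transformations, considered on the invariant set `X` only, that is closed under
composition and contains, up to equality on `X`, exactly one transformation with image `P` for
each non-empty subset `P` of `X`. Restricting the transformations to `X` gives the transition
monoid of a minimal completely reachable automaton with state set `X`. -/
structure MinimalOn {α : Type*} (M : Set (α → α)) (X : Set α) : Prop where
  nonempty : X.Nonempty
  mapsTo : ∀ f ∈ M, Set.MapsTo f X X
  comp : ∀ f ∈ M, ∀ g ∈ M, g ∘ f ∈ M
  exists_image : ∀ P ⊆ X, P.Nonempty → ∃ f ∈ M, f '' X = P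
  eqOn : ∀ f ∈ M, ∀ g ∈ M, f '' X = g '' X → Set.EqOn f g X

/-- The partition of `X` into `S` and `D` is the common kernel of all elements of rank two. -/
structure IsSplit {α : Type*} (M : Set (α → α)) (X S D : Set α) : Prop where
  union : S ∪ D = X
  disjoint : Disjoint S D
  left_nonempty : S.Nonempty
  right_nonempty : D.Nonempty
  kernel : ∀ f ∈ M, ∀ x y, x ≠ y → f '' X = {x, y} → ∀ a ∈ X, ∀ b ∈ X,
    (f a = f b ↔ (a ∈ S ↔ b ∈ S))

/-- The elements of `M` that fix `D` pointwise and leave `S` invariant. -/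
def fixing {α : Type*} (M : Set (α → α)) (S D : Set α) : Set (α → α) :=
  {f | f ∈ M ∧ Set.EqOn f id D ∧ Set.MapsTo f S S}

namespace MinimalOn

variable {α : Type*} {M : Set (α → α)} {X S D : Set α}

/-- If two elements have ranks two and different kernels, some pair of points is separated by
both; going through the element whose image is that pair shows that the kernels agree. -/
theorem exists_isSplit (hM : MinimalOn M X) (hX : X.Nontrivial) : ∃ S D, IsSplit M X S D := by
  obtain ⟨x₀, hx₀, y₀, hy₀, hne₀⟩ := hX
  obtain ⟨f₀, hf₀, him₀⟩ := hM.exists_image {x₀, y₀}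
    (by rintro _ (rfl | rfl) <;> assumption) ⟨x₀, by simp⟩
  have hval : ∀ {f : α → α} {x y : α}, f '' X = {x, y} → ∀ a ∈ X, f a = x ∨ f a = y :=
    fun h a ha => h.subset (Set.mem_image_of_mem _ ha)
  obtain ⟨p, hp, hpx⟩ := him₀.superset (show x₀ ∈ ({x₀, y₀} : Set α) by simp)
  obtain ⟨q, hq, hqy⟩ := him₀.superset (show y₀ ∈ ({x₀, y₀} : Set α) by simp)
  refine ⟨{a | a ∈ X ∧ f₀ a = x₀}, {a | a ∈ X ∧ f₀ a = y₀}, ?_, ?_, ⟨p, hp, hpx⟩, ⟨q, hq, hqy⟩, ?_⟩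
  · ext a
    have := hval him₀ a
    simp only [Set.mem_union, Set.mem_ofPred_eq]
    tauto
  · rw [Set.disjoint_left]
    rintro a ⟨-, h₁⟩ ⟨-, h₂⟩
    exact hne₀ (h₁.symm.trans h₂)
  intro f hf x y hne him a ha b hb
  have key : f a = f b ↔ f₀ a = f₀ b := by
    obtain ⟨z, hz, w, hw, h₁, h₂⟩ : ∃ z ∈ X, ∃ w ∈ X, f z ≠ f w ∧ f₀ z ≠ f₀ w := by
      by_contra! hcon
      obtain ⟨a, ha, hax⟩ := him.superset (show x ∈ ({x, y} : Set α) by simp)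
      obtain ⟨b, hb, hby⟩ := him.superset (show y ∈ ({x, y} : Set α) by simp)
      have hab : f a ≠ f b := by rw [hax, hby]; exact hne
      have e := hcon a ha b hb hab
      rcases eq_or_ne (f₀ p) (f₀ a) with h | h
      · have h' : f₀ q ≠ f₀ a := by rw [← h, hpx, hqy]; exact hne₀.symm
        have e₁ : f q = f a := by by_contra hc; exact h' (hcon q hq a ha hc)
        have e₂ : f q = f b := by by_contra hc; exact h' ((hcon q hq b hb hc).trans e.symm)
        exact hab (e₁.symm.trans e₂)
      · have e₁ : f p = f a := by by_contra hc; exact h (hcon p hp a ha hc)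
        have e₂ : f p = f b := by by_contra hc; exact h ((hcon p hp b hb hc).trans e.symm)
        exact hab (e₁.symm.trans e₂)
    obtain ⟨h, hh, himh⟩ := hM.exists_image {z, w} (by rintro _ (rfl | rfl) <;> assumption)
      ⟨z, by simp⟩
    have hker : ∀ g ∈ M, ∀ u v, g '' X = {u, v} → g z ≠ g w → (g a = g b ↔ h a = h b) := by
      intro g hg u v himg hgzw
      have e : Set.EqOn (g ∘ h) g X := by
        refine hM.eqOn _ (hM.comp _ hh _ hg) _ hg ?_
        rw [Set.image_comp, himh, himg, Set.image_pair]
        have h₁ := hval himg z hz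
        have h₂ := hval himg w hw
        rcases h₁ with h₁ | h₁ <;> rcases h₂ with h₂ | h₂ <;> rw [h₁, h₂] at hgzw ⊢
        · exact (hgzw rfl).elim
        · exact Set.pair_comm _ _
        · exact (hgzw rfl).elim
      rw [← e ha, ← e hb]
      refine ⟨fun hab => ?_, fun hab => congrArg g hab⟩
      simp only [Function.comp] at hab
      rcases hval himh a ha with h₁ | h₁ <;> rcases hval himh b hb with h₂ | h₂ <;>
        rw [h₁, h₂] at hab ⊢
      exacts [(hgzw hab).elim, (hgzw hab.symm).elim]
    rw [hker f hf x y him h₁, hker f₀ hf₀ x₀ y₀ him₀ h₂]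
  rw [key]
  have h₁ := hval him₀ a ha
  have h₂ := hval him₀ b hb
  simp only [Set.mem_ofPred_eq, ha, hb, true_and]
  constructor
  · intro h; rw [h]
  · intro h
    rcases h₁ with h₁ | h₁
    · rw [h₁, h.1 h₁]
    · rcases h₂ with h₂ | h₂
      · rw [h₂, h.2 h₂]
      · rw [h₁, h₂]

end MinimalOn

namespace IsSplit

variable {α : Type*} {M : Set (α → α)} {X S D : Set α}

theorem symm (h : IsSplit M X S D) : IsSplit M X D S := by
  refine ⟨Set.union_comm D S ▸ h.union, h.disjoint.symm, h.right_nonempty, h.left_nonempty, ?_⟩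
  have hD : ∀ a ∈ X, (a ∈ D ↔ a ∉ S) := fun a ha => by
    rw [← h.union] at ha
    exact ⟨fun h' => Set.disjoint_right.1 h.disjoint h', ha.resolve_left⟩
  intro f hf x y hne him a ha b hb
  rw [h.kernel f hf x y hne him a ha b hb, hD a ha, hD b hb, not_iff_not]

theorem left_subset (h : IsSplit M X S D) : S ⊆ X := h.union ▸ Set.subset_union_left

theorem right_subset (h : IsSplit M X S D) : D ⊆ X := h.union ▸ Set.subset_union_right

/-- An element of rank two is idempotent if its image meets both kernel classes. -/
theorem apply_of_image_eq_pair (h : IsSplit M X S D) (hM : MinimalOn M X) {f : α → α} (hf : f ∈ M)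
    {x y : α} (hx : x ∈ S) (hy : y ∈ D) (him : f '' X = {x, y}) :
    (∀ a ∈ S, f a = x) ∧ ∀ a ∈ D, f a = y := by
  have hne : x ≠ y := fun e => Set.disjoint_left.1 h.disjoint hx (e ▸ hy)
  have hk := h.kernel f hf x y hne him
  have hxX := h.left_subset hx
  have hyX := h.right_subset hy
  have hxy : f x ≠ f y := fun e =>
    Set.disjoint_left.1 h.disjoint (((hk x hxX y hyX).1 e).1 hx) hy
  have h₁ : f x = x ∨ f x = y := him.subset (Set.mem_image_of_mem _ hxX)
  have h₂ : f y = x ∨ f y = y := him.subset (Set.mem_image_of_mem _ hyX)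
  have e : Set.EqOn (f ∘ f) f X := by
    refine hM.eqOn _ (hM.comp _ hf _ hf) _ hf ?_
    rw [Set.image_comp, him, Set.image_pair]
    rcases h₁ with h₁ | h₁ <;> rcases h₂ with h₂ | h₂ <;> rw [h₁, h₂] at hxy ⊢
    · exact (hxy rfl).elim
    · exact Set.pair_comm _ _
    · exact (hxy rfl).elim
  obtain ⟨a, ha, hax⟩ := him.superset (show x ∈ ({x, y} : Set α) by simp)
  obtain ⟨b, hb, hby⟩ := him.superset (show y ∈ ({x, y} : Set α) by simp)
  have hfx : f x = x := by have := e ha; rwa [Function.comp, hax] at this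
  have hfy : f y = y := by have := e hb; rwa [Function.comp, hby] at this
  refine ⟨fun c hc => ?_, fun c hc => ?_⟩
  · rw [← hfx]
    exact (hk c (h.left_subset hc) x hxX).2 ⟨fun _ => hx, fun _ => hc⟩
  · rw [← hfy]
    exact (hk c (h.right_subset hc) y hyX).2
      ⟨fun hc' => (Set.disjoint_left.1 h.disjoint hc' hc).elim,
        fun hy' => (Set.disjoint_left.1 h.disjoint hy' hy).elim⟩

theorem mapsTo_left (h : IsSplit M X S D) (hM : MinimalOn M X) {f : α → α} (hf : f ∈ M)
    (hS : (f '' X ∩ S).Nonempty) (hD : (f '' X ∩ D).Nonempty) : Set.MapsTo f S S := by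
  obtain ⟨x, ⟨a, ha, rfl⟩, hx⟩ := hS
  obtain ⟨y, ⟨b, hb, rfl⟩, hy⟩ := hD
  obtain ⟨g, hg, himg⟩ := hM.exists_image {f a, f b}
    (by rintro _ (rfl | rfl)
        exacts [h.left_subset hx, h.right_subset hy]) ⟨f a, by simp⟩
  obtain ⟨g₁, g₂⟩ := h.apply_of_image_eq_pair hM hg hx hy himg
  have him : (g ∘ f) '' X = {f a, f b} := by
    apply Set.Subset.antisymm
    · rw [← himg, Set.image_comp]
      exact Set.image_mono (hM.mapsTo f hf).image_subset
    · rintro _ (rfl | rfl)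
      exacts [⟨a, ha, g₁ _ hx⟩, ⟨b, hb, g₂ _ hy⟩]
  obtain ⟨c₁, -⟩ := h.apply_of_image_eq_pair hM (hM.comp _ hf _ hg) hx hy him
  intro c hc
  have hcX : f c ∈ S ∪ D := h.union ▸ hM.mapsTo f hf (h.left_subset hc)
  refine hcX.resolve_right fun hcD => ?_
  have e₁ : g (f c) = f a := c₁ c hc
  rw [g₂ _ hcD] at e₁
  exact Set.disjoint_left.1 h.disjoint hx (e₁ ▸ hy)

theorem mapsTo_right (h : IsSplit M X S D) (hM : MinimalOn M X) {f : α → α} (hf : f ∈ M)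
    (hS : (f '' X ∩ S).Nonempty) (hD : (f '' X ∩ D).Nonempty) : Set.MapsTo f D D :=
  h.symm.mapsTo_left hM hf hD hS

/-- The element with image `P ∪ D`, where `P ⊆ S`, fixes `D` pointwise: it permutes `D`, hence
agrees on `D` with the identity by uniqueness of the element with image `D`. -/
theorem exists_fixing (h : IsSplit M X S D) (hM : MinimalOn M X) {P : Set α} (hP : P ⊆ S)
    (hne : P.Nonempty) : ∃ f ∈ fixing M S D, f '' S = P := by
  obtain ⟨f, hf, him⟩ := hM.exists_image (P ∪ D)
    (h.union ▸ Set.union_subset_union_left _ hP) (hne.mono Set.subset_union_left)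
  have hS : (f '' X ∩ S).Nonempty := by
    obtain ⟨x, hx⟩ := hne
    exact ⟨x, him ▸ Or.inl hx, hP hx⟩
  have hD : (f '' X ∩ D).Nonempty := by
    obtain ⟨x, hx⟩ := h.right_nonempty
    exact ⟨x, him ▸ Or.inr hx, hx⟩
  have m₁ := h.mapsTo_left hM hf hS hD
  have m₂ := h.mapsTo_right hM hf hS hD
  have hdis := Set.disjoint_left.1 h.disjoint
  rw [← h.union, Set.image_union] at him
  have i₁ : f '' S = P := by
    apply Set.Subset.antisymm
    · intro x hx
      exact (him.subset (Or.inl hx)).resolve_right fun hxD => hdis (m₁.image_subset hx) hxD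
    · intro x hx
      exact (him.superset (Or.inl hx)).resolve_right fun hxD => hdis (hP hx) (m₂.image_subset hxD)
  have i₂ : f '' D = D := by
    apply m₂.image_subset.antisymm
    intro x hx
    exact (him.superset (Or.inr hx)).resolve_left fun hxS => hdis (m₁.image_subset hxS) hx
  obtain ⟨k, hk, himk⟩ := hM.exists_image D h.right_subset h.right_nonempty
  have e : Set.EqOn (f ∘ k) k X :=
    hM.eqOn _ (hM.comp _ hk _ hf) _ hk (by rw [Set.image_comp, himk, i₂])
  refine ⟨f, ⟨hf, fun x hx => ?_, m₁⟩, i₁⟩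
  obtain ⟨a, ha, rfl⟩ := himk.superset hx
  exact e ha

theorem image_of_mem_fixing (h : IsSplit M X S D) {f : α → α} (hf : f ∈ fixing M S D) :
    f '' X = f '' S ∪ D := by
  rw [← h.union, Set.image_union, hf.2.1.image_eq, Set.image_id]

theorem minimalOn_fixing (h : IsSplit M X S D) (hM : MinimalOn M X) :
    MinimalOn (fixing M S D) S where
  nonempty := h.left_nonempty
  mapsTo f hf := hf.2.2
  comp f hf g hg := ⟨hM.comp f hf.1 g hg.1, fun x hx => by
    rw [Function.comp, hf.2.1 hx]; exact hg.2.1 hx, hg.2.2.comp hf.2.2⟩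
  exists_image P hP hne := h.exists_fixing hM hP hne
  eqOn f hf g hg e := (hM.eqOn f hf.1 g hg.1 (by
    rw [h.image_of_mem_fixing hf, h.image_of_mem_fixing hg, e])).mono h.left_subset

end IsSplit

/-! ### The tree of a monoid with one transformation for each image -/

open LabelledTree

/-- The intrinsic order of the points: some element sends `S` to `x` and `D` to `y`. -/
def PairLE {α : Type*} (M : Set (α → α)) (S D : Set α) (x y : α) : Prop :=
  ∃ h ∈ M, (∀ a ∈ S, h a = x) ∧ ∀ a ∈ D, h a = y

/-- A tree `T` is oriented in accordance with the kernel classes `S`, `D` if an element of `M` whose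
image is the leaf set of `T` sends `S` below the son and `D` below the daughter of the root of
`T`. A tree with a single leaf is always oriented. -/
def Oriented {α : Type*} (M : Set (α → α)) (X S D : Set α) (T : LabelledTree α) : Prop :=
  ∀ t t', T = node t t' → ∃ k ∈ M, k '' X = T.labels ∧ Set.MapsTo k S t.labels ∧
    Set.MapsTo k D t'.labels

namespace IsSplit

variable {α : Type*} {M : Set (α → α)} {X S D : Set α}

theorem pairLE_antisymm (h : IsSplit M X S D) (hM : MinimalOn M X) {x y : α}
    (h₁ : PairLE M S D x y) (h₂ : PairLE M S D y x) : x = y := by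
  have him : ∀ {f : α → α} {x y : α}, (∀ a ∈ S, f a = x) → (∀ a ∈ D, f a = y) →
      f '' X = {x, y} := fun {f x y} hx hy => by
    rw [← h.union, Set.image_union, Set.image_congr hx, Set.image_congr hy,
      h.left_nonempty.image_const, h.right_nonempty.image_const]; rfl
  obtain ⟨f, hf, hfS, hfD⟩ := h₁
  obtain ⟨g, hg, hgS, hgD⟩ := h₂
  obtain ⟨a, ha⟩ := h.left_nonempty
  rw [← hfS a ha, ← hgS a ha]
  exact hM.eqOn f hf g hg (by rw [him hfS hfD, him hgS hgD, Set.pair_comm]) (h.left_subset ha)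

theorem pairLE_map (hM : MinimalOn M X) {x y : α} (h : PairLE M S D x y) {f : α → α}
    (hf : f ∈ M) : PairLE M S D (f x) (f y) := by
  obtain ⟨g, hg, hgS, hgD⟩ := h
  exact ⟨f ∘ g, hM.comp g hg f hf, fun a ha => congrArg f (hgS a ha),
    fun a ha => congrArg f (hgD a ha)⟩

theorem pairLE_of_before (hM : MinimalOn M X) {T : LabelledTree α} (hT : T.Distinct)
    (ho : Oriented M X S D T) {N : Set (α → α)} (hNM : N ⊆ M) (hN : MinimalOn N T.labels)
    (hh : ∀ f ∈ N, T.Hierarchical f) {x y : α} (hxy : T.Before x y) : PairLE M S D x y := by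
  obtain ⟨g, hg, him⟩ := hN.exists_image {x, y}
    (by rintro _ (rfl | rfl)
        exacts [hxy.mem.1, hxy.mem.2]) ⟨x, by simp⟩
  have hf := hh g hg
  rw [Hierarchical, him, hxy.prune_pair hT] at hf
  rcases T with _ | ⟨t, t'⟩
  · exact hf.elim
  obtain ⟨k, hk, -, k₁, k₂⟩ := ho t t' rfl
  exact ⟨g ∘ k, hM.comp k hk g (hNM hg), fun a ha => folds_leaf.1 hf.1 _ (k₁ ha),
    fun a ha => folds_leaf.1 hf.2 _ (k₂ ha)⟩

/-- Of a tree and its mirror image, one is oriented in accordance with the split. -/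
theorem exists_oriented (h : IsSplit M X S D) (hM : MinimalOn M X) {T : LabelledTree α}
    (hT : T.Distinct) (hTX : T.labels ⊆ X) {N : Set (α → α)} (hNM : N ⊆ M)
    (hN : MinimalOn N T.labels) (hh : ∀ f ∈ N, T.Hierarchical f) :
    Oriented M X S D T ∨ Oriented M X S D T.mirror := by
  rcases T with z | ⟨t, t'⟩
  · exact Or.inl fun _ _ e => by cases e
  obtain ⟨k, hk, himk⟩ := hM.exists_image _ hTX (labels_nonempty _)
  obtain ⟨x, hx⟩ := t.labels_nonempty
  obtain ⟨y, hy⟩ := t'.labels_nonempty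
  have hb : (node t t').Before x y := .inl ⟨hx, hy⟩
  have hne := hb.ne hT
  obtain ⟨g, hg, him⟩ := hN.exists_image {x, y}
    (by rintro _ (rfl | rfl)
        exacts [hb.mem.1, hb.mem.2]) ⟨x, by simp⟩
  have hf := hh g hg
  rw [Hierarchical, him, hb.prune_pair hT] at hf
  have g₁ := folds_leaf.1 hf.1
  have g₂ := folds_leaf.1 hf.2
  have himgk : (g ∘ k) '' X = {x, y} := by rw [Set.image_comp, himk, him]
  have hker := h.kernel _ (hM.comp k hk g (hNM hg)) x y hne himgk
  have hkm : ∀ a ∈ X, k a ∈ t.labels ∨ k a ∈ t'.labels := fun a ha =>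
    himk.subset (Set.mem_image_of_mem k ha)
  have hsame : ∀ a ∈ X, ∀ b ∈ X, (a ∈ S ↔ b ∈ S) → (k a ∈ t.labels ↔ k b ∈ t.labels) := by
    intro a ha b hb hab
    have e : g (k a) = g (k b) := (hker a ha b hb).2 hab
    rcases hkm a ha with h₁ | h₁ <;> rcases hkm b hb with h₂ | h₂
    · exact ⟨fun _ => h₂, fun _ => h₁⟩
    · rw [g₁ _ h₁, g₂ _ h₂] at e; exact (hne e).elim
    · rw [g₂ _ h₁, g₁ _ h₂] at e; exact (hne e.symm).elim
    · have := Set.disjoint_right.1 hT.1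
      exact ⟨fun h => (this h₁ h).elim, fun h => (this h₂ h).elim⟩
  have hdiff : ∀ a ∈ S, ∀ b ∈ D, (k a ∈ t.labels ↔ k b ∈ t'.labels) := by
    intro a ha b hb
    have e : g (k a) ≠ g (k b) := fun e => Set.disjoint_left.1 h.disjoint
      (((hker a (h.left_subset ha) b (h.right_subset hb)).1 e).1 ha) hb
    have hd := Set.disjoint_left.1 hT.1
    rcases hkm a (h.left_subset ha) with h₁ | h₁ <;> rcases hkm b (h.right_subset hb) with h₂ | h₂
    · exact (e (by rw [g₁ _ h₁, g₁ _ h₂])).elim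
    · exact ⟨fun _ => h₂, fun _ => h₁⟩
    · exact ⟨fun h => (hd h h₁).elim, fun h => (hd h₂ h).elim⟩
    · exact (e (by rw [g₂ _ h₁, g₂ _ h₂])).elim
  obtain ⟨a, ha⟩ := h.left_nonempty
  obtain ⟨b, hb'⟩ := h.right_nonempty
  have hS : ∀ c ∈ S, (k c ∈ t.labels ↔ k a ∈ t.labels) := fun c hc =>
    hsame c (h.left_subset hc) a (h.left_subset ha) ⟨fun _ => ha, fun _ => hc⟩
  by_cases hka : k a ∈ t.labels
  · refine Or.inl fun u u' e => ?_
    cases e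
    exact ⟨k, hk, himk, fun c hc => (hS c hc).2 hka, fun c hc => (hdiff a ha c hc).1 hka⟩
  · refine Or.inr fun u u' e => ?_
    rw [LabelledTree.mirror] at e
    cases e
    refine ⟨k, hk, by rw [himk, labels_mirror], fun c hc => ?_, fun c hc => ?_⟩
    · rw [labels_mirror]
      exact (hkm c (h.left_subset hc)).resolve_left fun hc' => hka ((hS c hc).1 hc')
    · rw [labels_mirror]
      exact (hkm c (h.right_subset hc)).resolve_right fun hc' => hka ((hdiff a ha c hc).2 hc')

/-- The elements whose image lies in `D`. The element `k` with image `D` folds the tree of `S`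
onto the son `t` and the tree of `D` onto the daughter `t'` of the root of the tree of `D`; the
other elements are products of `k` with elements fixing `S`. -/
theorem hierarchical_of_image_subset_right (h : IsSplit M X S D) (hM : MinimalOn M X)
    {T U : LabelledTree α} (hT : T.Distinct) (hU : U.Distinct) (hTS : T.labels = S)
    (hUD : U.labels = D) (hhT : ∀ f ∈ fixing M S D, T.Hierarchical f)
    (hhU : ∀ f ∈ fixing M D S, U.Hierarchical f) (hoT : Oriented M X S D T)
    (hoU : Oriented M X S D U) {f : α → α} (hf : f ∈ M) (hfD : f '' X ⊆ D) :
    (node T U).Hierarchical f := by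
  have hX : (node T U).labels = X := by rw [labels, hTS, hUD, h.union]
  have hfne : (f '' X).Nonempty := hM.nonempty.image f
  rw [Hierarchical, hX, prune_node_right (by
    rw [hTS, ← Set.disjoint_iff_inter_eq_empty]; exact h.disjoint.mono_right hfD)]
  rcases U with y | ⟨t, t'⟩
  · refine folds_leaf.2 fun x hx => ?_
    have : f x ∈ D := hfD (Set.mem_image_of_mem f (hX ▸ hx))
    rwa [← hUD] at this
  obtain ⟨k, hk, himk, k₁, k₂⟩ := hoU t t' rfl
  rw [hUD] at himk
  have hDt : t.labels ∪ t'.labels = D := hUD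
  have himSD : k '' S ∪ k '' D = t.labels ∪ t'.labels := by
    rw [← Set.image_union, h.union, himk, hDt]
  have hdis := Set.disjoint_left.1 hU.1
  have iS : k '' S = t.labels := by
    refine k₁.image_subset.antisymm fun x hx => ?_
    exact (himSD.superset (.inl hx)).resolve_right fun hx' => hdis hx (k₂.image_subset hx')
  have iD : k '' D = t'.labels := by
    refine k₂.image_subset.antisymm fun x hx => ?_
    exact (himSD.superset (.inr hx)).resolve_left fun hx' => hdis (k₁.image_subset hx') hx
  have hM' := h.symm.minimalOn_fixing hM
  -- On `D`, the map `k` agrees with the element fixing `S` that has the same image of `D`.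
  have foldD : Folds k (node t t') t' := by
    obtain ⟨m, hm, himm⟩ := h.symm.exists_fixing hM (P := t'.labels)
      (hDt ▸ Set.subset_union_right) t'.labels_nonempty
    have hm' := hhU m hm
    rw [Hierarchical, hUD, himm, prune_node_right hU.1.inter_eq, prune_eq_self le_rfl] at hm'
    refine hm'.congr fun x hx => ?_
    obtain ⟨a, ha, rfl⟩ := (himk.trans hDt.symm).superset hx
    exact hM.eqOn _ (hM.comp k hk m hm.1) _ (hM.comp k hk k hk)
      (by rw [Set.image_comp, Set.image_comp, himk, himm, iD]) ha
  have foldS : Folds k T t := by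
    refine folds_of_equivariant hT hU.2.1 (by rw [hTS, iS]) (fun P hP hne => ?_)
      (fun x y hxy hyx => ?_)
    · rw [hTS] at hP
      have hkP : k '' P ⊆ t.labels := iS ▸ Set.image_mono hP
      obtain ⟨g, hg, himg⟩ := h.exists_fixing hM hP hne
      obtain ⟨m, hm, himm⟩ := h.symm.exists_fixing hM (P := k '' P ∪ t'.labels)
        (hDt ▸ Set.union_subset_union_left _ hkP) ((hne.image k).mono Set.subset_union_left)
      have hg' := hhT g hg
      rw [Hierarchical, hTS, himg] at hg'
      have hm' := hhU m hm
      have e₁ : t.labels ∩ (k '' P ∪ t'.labels) = t.labels ∩ k '' P := by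
        rw [Set.inter_union_distrib_left, hU.1.inter_eq, Set.union_empty]
      rw [Hierarchical, hUD, himm, prune_node
        (by rw [e₁, Set.inter_eq_right.2 hkP]; exact hne.image k)
        (by rw [Set.inter_union_distrib_left, Set.inter_self]
            exact t'.labels_nonempty.mono Set.subset_union_right), prune_congr e₁] at hm'
      refine ⟨g, m, hg', hm'.1, fun x hx => ?_⟩
      refine hM.eqOn _ (hM.comp g hg.1 k hk) _ (hM.comp k hk m hm.1) ?_
        (h.left_subset (hTS ▸ hx))
      rw [Set.image_comp, Set.image_comp, himk, himm, h.image_of_mem_fixing hg, himg,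
        Set.image_union, iD]
    · have h₁ := pairLE_map hM (pairLE_of_before hM hT hoT (fun f hf => hf.1)
        (hTS.symm ▸ h.minimalOn_fixing hM) hhT hxy) hk
      have h₂ := pairLE_of_before hM hU hoU (N := fixing M D S) (fun f hf => hf.1)
        (hUD.symm ▸ hM') hhU (x := k y) (y := k x) (.inr (.inl hyx))
      exact hyx.ne hU.2.1 (h.pairLE_antisymm hM h₂ h₁)
  have fold : Folds k (node T (node t t')) (node t t') := ⟨foldS, foldD⟩
  obtain ⟨g, hg, himg⟩ := h.symm.exists_fixing hM hfD hfne
  have hg' := hhU g hg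
  rw [Hierarchical, hUD, himg] at hg'
  refine (hg'.comp fold).congr ?_
  rw [hX]
  exact hM.eqOn _ (hM.comp k hk g hg.1) _ hf (by rw [Set.image_comp, himk, himg])

/-- If the image of `f` meets both `S` and `D`, then `f` acts on `S` and on `D` separately. -/
theorem hierarchical_of_image_meets (h : IsSplit M X S D) (hM : MinimalOn M X)
    {T U : LabelledTree α} (hTS : T.labels = S)
    (hUD : U.labels = D) (hhT : ∀ f ∈ fixing M S D, T.Hierarchical f)
    (hhU : ∀ f ∈ fixing M D S, U.Hierarchical f) {f : α → α} (hf : f ∈ M)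
    (hS : (f '' X ∩ S).Nonempty) (hD : (f '' X ∩ D).Nonempty) : (node T U).Hierarchical f := by
  have hX : (node T U).labels = X := by rw [labels, hTS, hUD, h.union]
  obtain ⟨g, hg, himg⟩ := h.exists_fixing hM (P := f '' X ∩ S) Set.inter_subset_right hS
  obtain ⟨m, hm, himm⟩ := h.symm.exists_fixing hM (P := f '' X ∩ D) Set.inter_subset_right hD
  have e : Set.EqOn (m ∘ g) f X := by
    refine hM.eqOn _ (hM.comp g hg.1 m hm.1) _ hf ?_
    rw [Set.image_comp, h.image_of_mem_fixing hg, himg, Set.image_union, himm,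
      (hm.2.1.mono Set.inter_subset_right).image_eq, Set.image_id, ← Set.inter_union_distrib_left,
      h.union]
    exact Set.inter_eq_left.2 (hM.mapsTo f hf).image_subset
  rw [Hierarchical, hX, prune_node (by rwa [hTS, Set.inter_comm]) (by rwa [hUD, Set.inter_comm])]
  have hg' := hhT g hg
  have hm' := hhU m hm
  rw [Hierarchical, hTS, himg, prune_congr (R := f '' X) (by rw [hTS]; ext; simp; tauto)] at hg'
  rw [Hierarchical, hUD, himm, prune_congr (R := f '' X) (by rw [hUD]; ext; simp; tauto)] at hm'
  refine ⟨hg'.congr fun x hx => ?_, hm'.congr fun x hx => ?_⟩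
  · rw [hTS] at hx
    rw [← e (h.left_subset hx)]
    exact (hm.2.1 (hg.2.2 hx)).symm
  · rw [hUD] at hx
    rw [← e (h.right_subset hx), Function.comp, hg.2.1 hx]; rfl

end IsSplit

theorem LabelledTree.Hierarchical.mirror {α : Type*} {T : LabelledTree α} {f : α → α}
    (h : T.Hierarchical f) (hf : Set.MapsTo f T.labels T.labels) : T.mirror.Hierarchical f := by
  have := Folds.mirror h
  rwa [← prune_mirror, ← labels_mirror T] at this
  rw [Set.inter_eq_right.2 hf.image_subset]
  exact T.labels_nonempty.image f

/-- Every monoid with exactly one transformation for each non-empty image consists of the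
hierarchical maps of some tree. -/
theorem MinimalOn.exists_labelledTree {α : Type*} {M : Set (α → α)} {X : Set α}
    (hM : MinimalOn M X) (hX : X.Finite) :
    ∃ T : LabelledTree α, T.Distinct ∧ T.labels = X ∧ ∀ f ∈ M, T.Hierarchical f := by
  induction hn : X.ncard using Nat.strong_induction_on generalizing M X with
  | _ n ih =>
  subst hn
  rcases Set.subsingleton_or_nontrivial X with hX' | hX'
  · obtain ⟨x, rfl⟩ := hX'.eq_empty_or_singleton.resolve_left hM.nonempty.ne_empty
    exact ⟨leaf x, trivial, rfl, fun f hf => folds_leaf.2 fun y hy => hM.mapsTo f hf hy⟩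
  obtain ⟨S, D, h⟩ := hM.exists_isSplit hX'
  have key : ∀ {S D : Set α}, IsSplit M X S D → ∃ T : LabelledTree α, T.Distinct ∧ T.labels = S ∧
      ∀ f ∈ fixing M S D, T.Hierarchical f := fun {S D} h => by
    refine ih _ (Set.ncard_lt_ncard ?_ hX) (h.minimalOn_fixing hM) (hX.subset h.left_subset) rfl
    refine h.left_subset.ssubset_of_ne fun e => ?_
    obtain ⟨y, hy⟩ := h.right_nonempty
    exact Set.disjoint_left.1 h.disjoint (e ▸ h.right_subset hy) hy
  have key' : ∀ {S' D' : Set α}, IsSplit M X S' D' → ∃ T : LabelledTree α, T.Distinct ∧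
      T.labels = S' ∧ (∀ f ∈ fixing M S' D', T.Hierarchical f) ∧ Oriented M X S D T := by
    intro S' D' h'
    obtain ⟨T, hT, hTS, hh⟩ := key h'
    rcases h.exists_oriented hM hT (hTS ▸ h'.left_subset) (N := fixing M S' D') (fun f hf => hf.1)
      (hTS ▸ h'.minimalOn_fixing hM) hh with ho | ho
    · exact ⟨T, hT, hTS, hh, ho⟩
    · exact ⟨T.mirror, hT.mirror, by rw [labels_mirror, hTS],
        fun f hf => (hh f hf).mirror (hTS ▸ hf.2.2), ho⟩
  obtain ⟨T, hT, hTS, hhT, hoT⟩ := key' h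
  obtain ⟨U, hU, hUD, hhU, hoU⟩ := key' h.symm
  have hlab : (node T U).labels = X := by rw [labels, hTS, hUD, h.union]
  refine ⟨node T U, ⟨hTS ▸ hUD ▸ h.disjoint, hT, hU⟩, hlab, fun f hf => ?_⟩
  have hsub : f '' X ⊆ S ∪ D := h.union ▸ (hM.mapsTo f hf).image_subset
  rcases (f '' X ∩ S).eq_empty_or_nonempty with h₁ | h₁
  · exact h.hierarchical_of_image_subset_right hM hT hU hTS hUD hhT hhU hoT hoU hf
      fun x hx => (hsub hx).resolve_left fun hx' => h₁.subset ⟨hx, hx'⟩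
  rcases (f '' X ∩ D).eq_empty_or_nonempty with h₂ | h₂
  · -- The mirror image of the previous case, with `S` and `D` interchanged.
    have mir : ∀ {V : LabelledTree α}, Oriented M X S D V → Oriented M X D S V.mirror := by
      rintro (_ | ⟨v, v'⟩) ho t t' e
      · cases e
      · rw [LabelledTree.mirror] at e
        cases e
        obtain ⟨k, hk, him, k₁, k₂⟩ := ho v v' rfl
        exact ⟨k, hk, by rw [him, labels_mirror], by rwa [labels_mirror], by rwa [labels_mirror]⟩
    have := h.symm.hierarchical_of_image_subset_right hM hU.mirror hT.mirror
      (by rw [labels_mirror, hUD]) (by rw [labels_mirror, hTS])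
      (fun f hf => (hhU f hf).mirror (hUD ▸ hf.2.2)) (fun f hf => (hhT f hf).mirror (hTS ▸ hf.2.2))
      (mir hoU) (mir hoT) hf fun x hx => (hsub hx).resolve_right fun hx' => h₂.subset ⟨hx, hx'⟩
    have hm := this.mirror (by
      rw [labels, labels_mirror, labels_mirror, hTS, hUD, h.symm.union]; exact hM.mapsTo f hf)
    simpa [LabelledTree.mirror] using hm
  · exact h.hierarchical_of_image_meets hM hTS hUD hhT hhU hf h₁ h₂

/-! ### Marked trees as labelled trees -/

namespace FullTree

open Vertex

/-- A marked tree as a labelled tree; the label of a leaf is the point of its interval. -/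
def toLabelled : (Γ : FullTree) → (Vertex Γ → NonemptyInterval ℕ) → LabelledTree ℕ
  | leaf, μ => .leaf (μ root).fst
  | node l r, μ => .node (l.toLabelled fun w => μ (left w)) (r.toLabelled fun w => μ (right w))

/-- The labelled tree of the subtree rooted at a vertex. -/
def toLabelledAt : {Γ : FullTree} → (Vertex Γ → NonemptyInterval ℕ) → Vertex Γ → LabelledTree ℕ
  | Γ, μ, root => Γ.toLabelled μ
  | _, μ, left v => toLabelledAt (fun w => μ (left w)) v
  | _, μ, right v => toLabelledAt (fun w => μ (right w)) v

@[simp] theorem shape_toLabelled (Γ : FullTree) (μ : Vertex Γ → NonemptyInterval ℕ) :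
    (Γ.toLabelled μ).shape = Γ := by
  induction Γ with
  | leaf => rfl
  | node l r hl hr => rw [toLabelled, shape, hl, hr]

theorem labels_toLabelled {Γ : FullTree} {μ : Vertex Γ → NonemptyInterval ℕ} (hμ : IsFaithful μ) :
    (Γ.toLabelled μ).labels = {x | x ∈ μ root} := by
  induction Γ with
  | leaf =>
    obtain ⟨y, hy⟩ := hμ.eq_pure (v := root) rfl
    ext x
    simp [toLabelled, labels, hy, NonemptyInterval.mem_pure]
  | node l r hl hr =>
    rw [toLabelled, labels, hl hμ.left, hr hμ.right]
    ext x
    exact (hμ.mem_root x).symm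

theorem distinct_toLabelled {Γ : FullTree} {μ : Vertex Γ → NonemptyInterval ℕ}
    (hμ : IsFaithful μ) : (Γ.toLabelled μ).Distinct := by
  induction Γ with
  | leaf => trivial
  | node l r hl hr =>
    refine ⟨?_, hl hμ.left, hr hμ.right⟩
    rw [labels_toLabelled hμ.left, labels_toLabelled hμ.right, Set.disjoint_left]
    obtain ⟨k, h₁, h₂, h₃, h₄, h₅, h₆⟩ := hμ.split root (left root) (right root) .root .root
    intro x hx hx'
    simp only [Set.mem_ofPred_eq, NonemptyInterval.mem_def] at hx hx'
    omega

theorem mem_labels_toLabelled {Γ : FullTree} {μ : Vertex Γ → NonemptyInterval ℕ}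
    (hμ : IsFaithful μ) {x : ℕ} : x ∈ (Γ.toLabelled μ).labels ↔ x ∈ μ root := by
  rw [labels_toLabelled hμ]; rfl

theorem IsFaithful.notMem_right {l r : FullTree} {μ : Vertex (node l r) → NonemptyInterval ℕ}
    (hμ : IsFaithful μ) {x : ℕ} (hx : x ∈ μ (.left root)) : x ∉ μ (.right root) := fun hx' =>
  Set.disjoint_left.1 (distinct_toLabelled hμ).1 ((mem_labels_toLabelled hμ.left).2 hx)
    ((mem_labels_toLabelled hμ.right).2 hx')

theorem IsFaithful.notMem_left {l r : FullTree} {μ : Vertex (node l r) → NonemptyInterval ℕ}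
    (hμ : IsFaithful μ) {x : ℕ} (hx : x ∈ μ (.right root)) : x ∉ μ (.left root) := fun hx' =>
  hμ.notMem_right hx' hx

theorem toLabelledAt_spec {Γ : FullTree} {μ : Vertex Γ → NonemptyInterval ℕ} (hμ : IsFaithful μ)
    (v : Vertex Γ) :
    (toLabelledAt μ v).Distinct ∧ (toLabelledAt μ v).labels = {x | x ∈ μ v} := by
  induction v with
  | root => exact ⟨distinct_toLabelled hμ, labels_toLabelled hμ⟩
  | left v ih => exact ih hμ.left
  | right v ih => exact ih hμ.right

theorem toLabelledAt_eq_node {Γ : FullTree} (μ : Vertex Γ → NonemptyInterval ℕ) {v s d : Vertex Γ}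
    (hs : IsSon s v) (hd : IsDaughter d v) :
    toLabelledAt μ v = .node (toLabelledAt μ s) (toLabelledAt μ d) := by
  induction v with
  | root => cases hs; cases hd; rfl
  | left v ih =>
    cases hs with | left hs => ?_
    cases hd with | left hd => ?_
    exact ih _ hs hd
  | right v ih =>
    cases hs with | right hs => ?_
    cases hd with | right hd => ?_
    exact ih _ hs hd

/-! ### Subordination and folds -/

/-- A map `ξ` that preserves sons and daughters marks a copy of `Γ₁` below `ξ root`; collapsing what
lies below the leaves of the copy is a fold. -/
theorem exists_folds_of_preserves {Γ₁ Γ₂ : FullTree} {μ₁ : Vertex Γ₁ → NonemptyInterval ℕ}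
    {μ₂ : Vertex Γ₂ → NonemptyInterval ℕ} (h₂ : IsFaithful μ₂) {ξ : Vertex Γ₁ → Vertex Γ₂}
    (hs : ∀ s v, IsSon s v → IsSon (ξ s) (ξ v))
    (hd : ∀ d v, IsDaughter d v → IsDaughter (ξ d) (ξ v)) :
    ∃ f, Folds f (toLabelledAt μ₂ (ξ root)) (Γ₁.toLabelled μ₁) := by
  classical
  induction Γ₁ with
  | leaf => exact ⟨fun _ => _, folds_leaf.2 fun _ _ => rfl⟩
  | node l r hl hr =>
    obtain ⟨f, hf⟩ := hl (μ₁ := fun w => μ₁ (left w)) (ξ := fun w => ξ (left w))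
      (fun s v h => hs _ _ (.left h)) (fun s v h => hd _ _ (.left h))
    obtain ⟨g, hg⟩ := hr (μ₁ := fun w => μ₁ (right w)) (ξ := fun w => ξ (right w))
      (fun s v h => hs _ _ (.right h)) (fun s v h => hd _ _ (.right h))
    have e := toLabelledAt_eq_node μ₂ (hs (left root) root .root) (hd (right root) root .root)
    have hdis := (toLabelledAt_spec h₂ (ξ root)).1
    rw [e] at hdis ⊢
    exact ⟨fun x => if x ∈ (toLabelledAt μ₂ (ξ (left root))).labels then f x else g x,
      hf.congr fun x hx => (if_pos hx).symm,
      hg.congr fun x hx => (if_neg (Set.disjoint_right.1 hdis.1 hx)).symm⟩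

/-- The values of a fold are read off from any map that preserves sons and daughters. -/
theorem _root_.LabelledTree.Folds.apply_eq {Γ₁ Γ₂ : FullTree} {μ₁ : Vertex Γ₁ → NonemptyInterval ℕ}
    {μ₂ : Vertex Γ₂ → NonemptyInterval ℕ} (h₂ : IsFaithful μ₂) {ξ : Vertex Γ₁ → Vertex Γ₂}
    (hs : ∀ s v, IsSon s v → IsSon (ξ s) (ξ v))
    (hd : ∀ d v, IsDaughter d v → IsDaughter (ξ d) (ξ v)) {f : ℕ → ℕ}
    (hf : Folds f (toLabelledAt μ₂ (ξ root)) (Γ₁.toLabelled μ₁)) {ℓ : Vertex Γ₁} (hℓ : ℓ.IsLeaf)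
    {x : ℕ} (hx : x ∈ μ₂ (ξ ℓ)) : f x = (μ₁ ℓ).fst := by
  induction Γ₁ with
  | leaf =>
    cases ℓ
    refine folds_leaf.1 hf x ?_
    rw [(toLabelledAt_spec h₂ _).2]; exact hx
  | node l r hl hr =>
    rw [toLabelledAt_eq_node μ₂ (hs (left root) root .root) (hd (right root) root .root)] at hf
    cases ℓ with
    | root => cases hℓ
    | left ℓ =>
      exact hl (μ₁ := fun w => μ₁ (left w)) (ξ := fun w => ξ (left w))
        (fun s v h => hs _ _ (.left h)) (fun s v h => hd _ _ (.left h)) hf.1 hℓ hx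
    | right ℓ =>
      exact hr (μ₁ := fun w => μ₁ (right w)) (ξ := fun w => ξ (right w))
        (fun s v h => hs _ _ (.right h)) (fun s v h => hd _ _ (.right h)) hf.2 hℓ hx

/-- The value chosen in the definition of `transfer` does not depend on the homomorphism. -/
theorem folds_transfer {Γ₁ Γ₂ : FullTree} {μ₁ : Vertex Γ₁ → NonemptyInterval ℕ}
    {μ₂ : Vertex Γ₂ → NonemptyInterval ℕ} (h : Subordinates Γ₁ Γ₂) (h₁ : IsFaithful μ₁)
    (h₂ : IsFaithful μ₂) : Folds (transfer μ₁ μ₂) (Γ₂.toLabelled μ₂) (Γ₁.toLabelled μ₁) := by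
  obtain ⟨ξ, hξ, hinj⟩ := h
  obtain ⟨f, hf⟩ := exists_folds_of_preserves (μ₁ := μ₁) h₂ hξ.map_son hξ.map_daughter
  rw [hξ.map_root] at hf
  change Folds f (Γ₂.toLabelled μ₂) (Γ₁.toLabelled μ₁) at hf
  refine hf.congr fun x hx => ?_
  rw [labels_toLabelled h₂] at hx
  obtain ⟨ℓ, hℓ, hxℓ⟩ := hξ.exists_leaf h₂ hx
  obtain ⟨y, hy⟩ := h₁.eq_pure hℓ
  obtain ⟨ξ', hξ', -, ℓ', hℓ', hxℓ', h'⟩ := Classical.epsilon_spec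
    (p := fun y => ∃ ξ : Vertex Γ₁ → Vertex Γ₂, IsHom ξ ∧ Function.Injective ξ ∧
      ∃ ℓ : Vertex Γ₁, ℓ.IsLeaf ∧ x ∈ μ₂ (ξ ℓ) ∧ μ₁ ℓ = NonemptyInterval.pure y)
    ⟨y, ξ, hξ, hinj, ℓ, hℓ, hxℓ, hy⟩
  have := Folds.apply_eq (μ₁ := μ₁) h₂ hξ'.map_son hξ'.map_daughter (f := f)
    (by rw [hξ'.map_root]; exact hf) hℓ' hxℓ'
  rw [this, h']
  rfl

theorem subordinates_of_folds {α β : Type*} {f : α → β} {T : LabelledTree α} {U : LabelledTree β}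
    (h : Folds f T U) : Subordinates U.shape T.shape := by
  induction U generalizing T with
  | leaf y =>
    refine ⟨fun _ => root, ⟨rfl, ?_, ?_⟩, ?_⟩
    · rintro s v ⟨⟩
    · rintro s v ⟨⟩
    · rintro ⟨⟩ ⟨⟩ -; rfl
  | node c d hc hd =>
    rcases T with _ | ⟨a, b⟩
    · exact h.elim
    obtain ⟨ξ, hξ, hξi⟩ := hc h.1
    obtain ⟨ζ, hζ, hζi⟩ := hd h.2
    refine ⟨fun v => match v with
      | root => root
      | left v => left (ξ v)
      | right v => right (ζ v), ⟨rfl, ?_, ?_⟩, ?_⟩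
    · rintro s v (_ | hs | hs)
      · change IsSon (left (ξ root)) root
        rw [hξ.map_root]; exact .root
      · exact .left (hξ.map_son _ _ hs)
      · exact .right (hζ.map_son _ _ hs)
    · rintro s v (_ | hs | hs)
      · change IsDaughter (right (ζ root)) root
        rw [hζ.map_root]; exact .root
      · exact .left (hξ.map_daughter _ _ hs)
      · exact .right (hζ.map_daughter _ _ hs)
    · rintro (_ | v | v) (_ | w | w) e
      · rfl
      · cases e
      · cases e
      · cases e
      · exact congrArg _ (hξi (Vertex.left.inj e))
      · cases e
      · cases e
      · cases e
      · exact congrArg _ (hζi (Vertex.right.inj e))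

/-- If a tree folds onto all trees spanned by some of its leaves, it is respectful. -/
theorem respectful_of_folds {α : Type*} {T : LabelledTree α} (hT : T.Distinct)
    (h : ∀ P ⊆ T.labels, P.Nonempty → ∃ f : α → α, Folds f T (T.prune P)) :
    Respectful T.shape := by
  induction T with
  | leaf x => exact ⟨(by rintro p s d t ⟨⟩), (by rintro p s d t ⟨⟩)⟩
  | node a b ha hb =>
    have e₁ : b.labels ∩ a.labels = ∅ := hT.1.symm.inter_eq
    have e₂ : a.labels ∩ b.labels = ∅ := hT.1.inter_eq
    have ha' := ha hT.2.1 fun P hP hne => by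
      obtain ⟨f, hf⟩ := h (P ∪ b.labels) (Set.union_subset_union_left _ hP)
        (hne.mono Set.subset_union_left)
      have e : a.labels ∩ (P ∪ b.labels) = a.labels ∩ P := by
        rw [Set.inter_union_distrib_left, e₂, Set.union_empty]
      rw [prune_node (by rw [e, Set.inter_eq_right.2 hP]; exact hne)
        (by rw [Set.inter_union_distrib_left, Set.inter_self]
            exact b.labels_nonempty.mono Set.subset_union_right), prune_congr e] at hf
      exact ⟨f, hf.1⟩
    have hb' := hb hT.2.2 fun P hP hne => by
      obtain ⟨f, hf⟩ := h (a.labels ∪ P) (Set.union_subset_union_right _ hP)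
        (hne.mono Set.subset_union_right)
      have e : b.labels ∩ (a.labels ∪ P) = b.labels ∩ P := by
        rw [Set.inter_union_distrib_left, e₁, Set.empty_union]
      rw [prune_node (by rw [Set.inter_union_distrib_left, Set.inter_self]
                         exact a.labels_nonempty.mono Set.subset_union_left)
        (by rw [e, Set.inter_eq_right.2 hP]; exact hne), prune_congr e] at hf
      exact ⟨f, hf.2⟩
    refine ⟨?_, ?_⟩
    · rintro p s d t (_ | hs | hs) hd ht
      · cases hd
        obtain ⟨f, hf⟩ := h b.labels Set.subset_union_right b.labels_nonempty
        rw [prune_node_right e₂, prune_eq_self le_rfl] at hf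
        rcases b with _ | ⟨c, c'⟩
        · cases ht with | right ht => cases ht
        · cases ht with
          | right ht =>
            cases ht
            exact subordinates_of_folds hf.1
      · cases hd with | left hd => ?_
        cases ht with | left ht => ?_
        exact ha'.nephew _ _ _ _ hs hd ht
      · cases hd with | right hd => ?_
        cases ht with | right ht => ?_
        exact hb'.nephew _ _ _ _ hs hd ht
    · rintro p s d t (_ | hs | hs) hd ht
      · cases hd
        obtain ⟨f, hf⟩ := h a.labels Set.subset_union_left a.labels_nonempty
        rw [prune_node_left e₁ (by rw [Set.inter_self]; exact a.labels_nonempty),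
          prune_eq_self le_rfl] at hf
        rcases a with _ | ⟨c, c'⟩
        · cases ht with | left ht => cases ht
        · cases ht with
          | left ht =>
            cases ht
            exact subordinates_of_folds hf.2
      · cases hd with | left hd => ?_
        cases ht with | left ht => ?_
        exact ha'.niece _ _ _ _ hs hd ht
      · cases hd with | right hd => ?_
        cases ht with | right ht => ?_
        exact hb'.niece _ _ _ _ hs hd ht

/-! ### The letters of the automaton of a respectful tree -/

theorem act_left {l r : FullTree} {μ : Vertex (node l r) → NonemptyInterval ℕ} {v : Vertex l}
    (hv : v ≠ root) (x : ℕ) [Decidable (x ∈ μ (left root))] : act (node l r) μ (left v) x =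
      if x ∈ μ (left root) then act l (fun w => μ (left w)) v x else x := by
  suffices H : ∀ y, y = act l (fun w => μ (left w)) v x → act (node l r) μ (left v) x =
      if x ∈ μ (left root) then y else x from H _ rfl
  intro y hy
  rcases v with _ | v | v
  · exact (hv rfl).elim
  all_goals
    rw [act]
    · rw [hy]; congr
    all_goals exact nofun

theorem act_right {l r : FullTree} {μ : Vertex (node l r) → NonemptyInterval ℕ} {v : Vertex r}
    (hv : v ≠ root) (x : ℕ) [Decidable (x ∈ μ (right root))] : act (node l r) μ (right v) x =
      if x ∈ μ (right root) then act r (fun w => μ (right w)) v x else x := by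
  suffices H : ∀ y, y = act r (fun w => μ (right w)) v x → act (node l r) μ (right v) x =
      if x ∈ μ (right root) then y else x from H _ rfl
  intro y hy
  rcases v with _ | v | v
  · exact (hv rfl).elim
  all_goals
    rw [act]
    · rw [hy]; congr
    all_goals exact nofun

/-- A proper subtree does not contain all leaves. -/
theorem exists_mem_diff {Γ : FullTree} {μ : Vertex Γ → NonemptyInterval ℕ} (hμ : IsFaithful μ)
    {v : Vertex Γ} (hv : v ≠ root) : ∃ x, x ∈ μ root ∧ x ∉ μ v := by
  have hfst : ∀ I : NonemptyInterval ℕ, I.fst ∈ I := fun I => ⟨le_rfl, I.fst_le_snd⟩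
  cases v with
  | root => exact (hv rfl).elim
  | left v =>
    exact ⟨_, (hμ.mem_root _).2 (.inr (hfst _)), fun h =>
      hμ.notMem_left (hfst _) (hμ.left.mem_root_of_mem v h)⟩
  | right v =>
    exact ⟨_, (hμ.mem_root _).2 (.inl (hfst _)), fun h =>
      hμ.notMem_right (hfst _) (hμ.right.mem_root_of_mem v h)⟩

/-- The letter of the son of the root folds the whole tree onto the tree of the daughter. -/
theorem folds_act_left_root {l r : FullTree} {μ : Vertex (node l r) → NonemptyInterval ℕ}
    (hΓ : Respectful (node l r)) (hμ : IsFaithful μ)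
    (ih : ∀ v : Vertex r, v ≠ root → Folds (act r (fun w => μ (right w)) v)
      (r.toLabelled fun w => μ (right w))
      ((r.toLabelled fun w => μ (right w)).prune {x | x ∉ μ (right v)})) :
    Folds (act (node l r) μ (left root)) ((node l r).toLabelled μ)
      (r.toLabelled fun w => μ (right w)) := by
  rcases r with _ | ⟨t, t'⟩
  · exact folds_leaf.2 fun _ _ => by rw [act]
  refine ⟨?_, ?_⟩
  · refine (folds_transfer (hΓ.nephew root (left root) (right root) (right (left root)) .root
      .root (.right .root)) hμ.right.left hμ.left).congr fun x hx => ?_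
    rw [act, if_pos ((mem_labels_toLabelled hμ.left).1 hx)]
    rfl
  · have h := ih (left root) nofun
    rw [toLabelled, prune_node_right, prune_eq_self] at h
    · refine h.congr fun x hx => ?_
      rw [act, if_neg (hμ.notMem_left ((mem_labels_toLabelled hμ.right).1 hx))]
    · exact fun x hx => hμ.right.notMem_left ((mem_labels_toLabelled hμ.right.right).1 hx)
    · exact Set.eq_empty_of_forall_notMem fun x hx =>
        hx.2 ((mem_labels_toLabelled hμ.right.left).1 hx.1)

/-- The letter of the daughter of the root folds the whole tree onto the tree of the son. -/
theorem folds_act_right_root {l r : FullTree} {μ : Vertex (node l r) → NonemptyInterval ℕ}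
    (hΓ : Respectful (node l r)) (hμ : IsFaithful μ)
    (ih : ∀ v : Vertex l, v ≠ root → Folds (act l (fun w => μ (left w)) v)
      (l.toLabelled fun w => μ (left w))
      ((l.toLabelled fun w => μ (left w)).prune {x | x ∉ μ (left v)})) :
    Folds (act (node l r) μ (right root)) ((node l r).toLabelled μ)
      (l.toLabelled fun w => μ (left w)) := by
  rcases l with _ | ⟨t', t⟩
  · exact folds_leaf.2 fun _ _ => by rw [act]
  refine ⟨?_, ?_⟩
  · have h := ih (right root) nofun
    have hsub : (t'.toLabelled fun w => μ (left (left w))).labels ⊆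
        {x | x ∉ μ (left (right root))} := fun x hx =>
      hμ.left.notMem_right ((mem_labels_toLabelled hμ.left.left).1 hx)
    rw [toLabelled, prune_node_left, prune_eq_self hsub] at h
    · refine h.congr fun x hx => ?_
      rw [act, if_neg (hμ.notMem_right ((mem_labels_toLabelled hμ.left).1 hx))]
    · exact Set.eq_empty_of_forall_notMem fun x hx =>
        hx.2 ((mem_labels_toLabelled hμ.left.right).1 hx.1)
    · rw [Set.inter_eq_left.2 hsub]; exact labels_nonempty _
  · refine (folds_transfer (hΓ.niece root (left root) (right root) (left (right root)) .root
      .root (.left .root)) hμ.left.right hμ.right).congr fun x hx => ?_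
    rw [act, if_pos ((mem_labels_toLabelled hμ.right).1 hx)]
    rfl

/-- The letter of a vertex `v` folds the tree onto the tree spanned by the leaves not below `v`. -/
theorem folds_act {Γ : FullTree} {μ : Vertex Γ → NonemptyInterval ℕ} (hΓ : Respectful Γ)
    (hμ : IsFaithful μ) {v : Vertex Γ} (hv : v ≠ root) :
    Folds (act Γ μ v) (Γ.toLabelled μ) ((Γ.toLabelled μ).prune {x | x ∉ μ v}) := by
  classical
  induction Γ with
  | leaf => cases v; exact (hv rfl).elim
  | node l r hl hr =>
    have ml := fun x => mem_labels_toLabelled hμ.left (x := x)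
    have mr := fun x => mem_labels_toLabelled hμ.right (x := x)
    rcases v with _ | v | v
    · exact (hv rfl).elim
    · have hsub : (r.toLabelled fun w => μ (right w)).labels ⊆ {x | x ∉ μ (left v)} :=
        fun x hx hx' => hμ.notMem_left ((mr x).1 hx) (hμ.left.mem_root_of_mem v hx')
      by_cases hv' : v = root
      · subst hv'
        rw [toLabelled, prune_node_right, prune_eq_self hsub]
        · exact folds_act_left_root hΓ hμ fun v hv => hr hΓ.right hμ.right hv
        · exact Set.eq_empty_of_forall_notMem fun x hx => hx.2 ((ml x).1 hx.1)
      · have h := hl hΓ.left hμ.left hv'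
        obtain ⟨z, hz, hz'⟩ := exists_mem_diff hμ.left hv'
        rw [toLabelled, prune_node ⟨z, (ml z).2 hz, hz'⟩
          (by rw [Set.inter_eq_left.2 hsub]; exact labels_nonempty _), prune_eq_self hsub]
        refine ⟨h.congr fun x hx => ?_, (Folds.id _).congr fun x hx => ?_⟩
        · rw [act_left hv', if_pos ((ml x).1 hx)]
        · rw [act_left hv', if_neg (hμ.notMem_left ((mr x).1 hx))]; rfl
    · have hsub : (l.toLabelled fun w => μ (left w)).labels ⊆ {x | x ∉ μ (right v)} :=
        fun x hx hx' => hμ.notMem_right ((ml x).1 hx) (hμ.right.mem_root_of_mem v hx')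
      by_cases hv' : v = root
      · subst hv'
        rw [toLabelled, prune_node_left, prune_eq_self hsub]
        · exact folds_act_right_root hΓ hμ fun v hv => hl hΓ.left hμ.left hv
        · exact Set.eq_empty_of_forall_notMem fun x hx => hx.2 ((mr x).1 hx.1)
        · rw [Set.inter_eq_left.2 hsub]; exact labels_nonempty _
      · have h := hr hΓ.right hμ.right hv'
        obtain ⟨z, hz, hz'⟩ := exists_mem_diff hμ.right hv'
        rw [toLabelled, prune_node (by rw [Set.inter_eq_left.2 hsub]; exact labels_nonempty _)
          ⟨z, (mr z).2 hz, hz'⟩, prune_eq_self hsub]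
        refine ⟨(Folds.id _).congr fun x hx => ?_, h.congr fun x hx => ?_⟩
        · rw [act_right hv', if_neg (hμ.notMem_right ((ml x).1 hx))]; rfl
        · rw [act_right hv', if_pos ((mr x).1 hx)]

theorem hierarchical_act {Γ : FullTree} {μ : Vertex Γ → NonemptyInterval ℕ} (hΓ : Respectful Γ)
    (hμ : IsFaithful μ) {v : Vertex Γ} (hv : v ≠ root) :
    (Γ.toLabelled μ).Hierarchical (act Γ μ v) := by
  have h := folds_act hΓ hμ hv
  obtain ⟨z, hz, hz'⟩ := exists_mem_diff hμ hv
  have him := h.image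
  rw [labels_prune (by rw [labels_toLabelled hμ]; exact ⟨z, hz, hz'⟩)] at him
  rw [Hierarchical, him, prune_congr (R := {x | x ∉ μ v})]
  · exact h
  · ext; simp

/-- The action of a word in the letters of a tree. -/
noncomputable def actWord {Γ : FullTree} (μ : Vertex Γ → NonemptyInterval ℕ) (w : List (Letter Γ))
    (x : ℕ) : ℕ := w.foldl (fun x (a : Letter Γ) => act Γ μ a.1 x) x

theorem actWord_append {Γ : FullTree} (μ : Vertex Γ → NonemptyInterval ℕ) (w w' : List (Letter Γ))
    (x : ℕ) : actWord μ (w ++ w') x = actWord μ w' (actWord μ w x) := by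
  simp only [actWord, List.foldl_append]

/-- A word of the left subtree, read in the whole tree. -/
def leftWord {l r : FullTree} (w : List (Letter l)) : List (Letter (node l r)) :=
  w.map fun a => ⟨left a, nofun⟩

/-- A word of the right subtree, read in the whole tree. -/
def rightWord {l r : FullTree} (w : List (Letter r)) : List (Letter (node l r)) :=
  w.map fun a => ⟨right a, nofun⟩

theorem actWord_leftWord_of_mem {l r : FullTree} {μ : Vertex (node l r) → NonemptyInterval ℕ}
    (hΓ : Respectful (node l r)) (hμ : IsFaithful μ) (w : List (Letter l)) {x : ℕ}
    (hx : x ∈ μ (left root)) :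
    actWord μ (leftWord w) x = actWord (fun w => μ (left w)) w x := by
  classical
  induction w generalizing x with
  | nil => rfl
  | cons a w ih =>
    change actWord μ (leftWord w) (act _ μ (left a) x) = actWord _ w (act l _ a x)
    rw [act_left a.2, if_pos hx]
    exact ih (act_mem hΓ.left hμ.left a hx)

theorem actWord_rightWord_of_mem {l r : FullTree} {μ : Vertex (node l r) → NonemptyInterval ℕ}
    (hΓ : Respectful (node l r)) (hμ : IsFaithful μ) (w : List (Letter r)) {x : ℕ}
    (hx : x ∈ μ (right root)) :
    actWord μ (rightWord w) x = actWord (fun w => μ (right w)) w x := by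
  classical
  induction w generalizing x with
  | nil => rfl
  | cons a w ih =>
    change actWord μ (rightWord w) (act _ μ (right a) x) = actWord _ w (act r _ a x)
    rw [act_right a.2, if_pos hx]
    exact ih (act_mem hΓ.right hμ.right a hx)

theorem actWord_leftWord_of_notMem {l r : FullTree} {μ : Vertex (node l r) → NonemptyInterval ℕ}
    (w : List (Letter l)) {x : ℕ} (hx : x ∉ μ (left root)) : actWord μ (leftWord w) x = x := by
  classical
  induction w with
  | nil => rfl
  | cons a w ih =>
    change actWord μ (leftWord w) (act _ μ (left a) x) = x
    rw [act_left a.2, if_neg hx, ih]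

theorem actWord_rightWord_of_notMem {l r : FullTree} {μ : Vertex (node l r) → NonemptyInterval ℕ}
    (w : List (Letter r)) {x : ℕ} (hx : x ∉ μ (right root)) : actWord μ (rightWord w) x = x := by
  classical
  induction w with
  | nil => rfl
  | cons a w ih =>
    change actWord μ (rightWord w) (act _ μ (right a) x) = x
    rw [act_right a.2, if_neg hx, ih]

/-- All non-empty sets of states are reachable. If the set lies on one side of the root, a letter of
a child of the root first moves all states to that side. -/
theorem exists_actWord_image_eq {Γ : FullTree} {μ : Vertex Γ → NonemptyInterval ℕ}
    (hΓ : Respectful Γ) (hμ : IsFaithful μ) {P : Set ℕ} (hP : P ⊆ {x | x ∈ μ root})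
    (hne : P.Nonempty) : ∃ w, actWord μ w '' {x | x ∈ μ root} = P := by
  induction Γ generalizing P with
  | leaf =>
    obtain ⟨y, hy⟩ := hμ.eq_pure (v := root) rfl
    have hroot : {x | x ∈ μ root} = {y} := by ext; simp [hy, NonemptyInterval.mem_pure]
    rw [hroot] at hP ⊢
    refine ⟨[], ?_⟩
    rw [(Set.subset_singleton_iff_eq.1 hP).resolve_left hne.ne_empty]
    exact Set.image_id _
  | node l r hl hr =>
    have hX : {x | x ∈ μ root} = {x | x ∈ μ (left root)} ∪ {x | x ∈ μ (right root)} := by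
      ext x; exact hμ.mem_root x
    have ll := labels_toLabelled hμ.left
    have lr := labels_toLabelled hμ.right
    have lX := labels_toLabelled hμ
    have iL : ∀ w : List (Letter l), actWord μ (leftWord w) '' {x | x ∈ μ (left root)} =
        actWord (fun w => μ (left w)) w '' {x | x ∈ μ (left root)} := fun w =>
      Set.image_congr fun x hx => actWord_leftWord_of_mem hΓ hμ w hx
    have iR : ∀ w : List (Letter r), actWord μ (rightWord w) '' {x | x ∈ μ (right root)} =
        actWord (fun w => μ (right w)) w '' {x | x ∈ μ (right root)} := fun w =>
      Set.image_congr fun x hx => actWord_rightWord_of_mem hΓ hμ w hx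
    have fL : ∀ (w : List (Letter l)) (R : Set ℕ), R ⊆ {x | x ∈ μ (right root)} →
        actWord μ (leftWord w) '' R = R := fun w R hR =>
      (Set.image_congr fun x hx => actWord_leftWord_of_notMem w (hμ.notMem_left (hR hx))).trans
        (Set.image_id _)
    have fR : ∀ (w : List (Letter r)) (R : Set ℕ), R ⊆ {x | x ∈ μ (left root)} →
        actWord μ (rightWord w) '' R = R := fun w R hR =>
      (Set.image_congr fun x hx => actWord_rightWord_of_notMem w (hμ.notMem_right (hR hx))).trans
        (Set.image_id _)
    rcases (P ∩ {x | x ∈ μ (left root)}).eq_empty_or_nonempty with h₁ | h₁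
    · have hP' : P ⊆ {x | x ∈ μ (right root)} := fun x hx =>
        (hX.subset (hP hx)).resolve_left fun h => h₁.subset ⟨hx, h⟩
      obtain ⟨w, hw⟩ := hr hΓ.right hμ.right hP' hne
      refine ⟨⟨left root, nofun⟩ :: rightWord w, ?_⟩
      have h := (folds_act_left_root hΓ hμ fun v hv => folds_act hΓ.right hμ.right hv).image
      rw [lX, lr] at h
      change (actWord μ (rightWord w) ∘ act _ μ (left root)) '' _ = P
      rw [Set.image_comp, h, iR, hw]
    rcases (P ∩ {x | x ∈ μ (right root)}).eq_empty_or_nonempty with h₂ | h₂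
    · have hP' : P ⊆ {x | x ∈ μ (left root)} := fun x hx =>
        (hX.subset (hP hx)).resolve_right fun h => h₂.subset ⟨hx, h⟩
      obtain ⟨w, hw⟩ := hl hΓ.left hμ.left hP' hne
      refine ⟨⟨right root, nofun⟩ :: leftWord w, ?_⟩
      have h := (folds_act_right_root hΓ hμ fun v hv => folds_act hΓ.left hμ.left hv).image
      rw [lX, ll] at h
      change (actWord μ (leftWord w) ∘ act _ μ (right root)) '' _ = P
      rw [Set.image_comp, h, iL, hw]
    · obtain ⟨w₁, hw₁⟩ := hl hΓ.left hμ.left (P := P ∩ {x | x ∈ μ (left root)})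
        Set.inter_subset_right h₁
      obtain ⟨w₂, hw₂⟩ := hr hΓ.right hμ.right (P := P ∩ {x | x ∈ μ (right root)})
        Set.inter_subset_right h₂
      refine ⟨leftWord w₁ ++ rightWord w₂, ?_⟩
      rw [Set.image_congr fun x _ => actWord_append μ (leftWord w₁) (rightWord w₂) x,
        ← Set.image_image, hX, Set.image_union, iL, hw₁, fL _ _ le_rfl, Set.image_union,
        fR _ _ Set.inter_subset_right, iR, hw₂, ← Set.inter_union_distrib_left, ← hX,
        Set.inter_eq_left.2 hP]

end FullTree

/-! ### Minimality in terms of trees -/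

namespace Automaton

variable {Q : Type u} {S : Type v} [Finite Q] [Finite S]

theorem run_append (A : Automaton Q S) (q : Q) (w w' : List S) :
    A.run q (w ++ w') = A.run (A.run q w) w' := by
  simp only [run, List.foldl_append]

theorem card_nonempty_sets (Q : Type*) [Finite Q] :
    Nat.card {P : Set Q // P.Nonempty} = 2 ^ Nat.card Q - 1 := by
  have h : Nat.card {P : Set Q // P.Nonempty} = ({∅}ᶜ : Set (Set Q)).ncard := by
    rw [← Nat.card_coe_set_eq]
    exact Nat.card_congr (Equiv.subtypeEquivRight fun P => Set.nonempty_iff_ne_empty)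
  rw [h, Set.ncard_compl, Set.ncard_singleton, ← Set.ncard_univ, ← Set.powerset_univ,
    Set.ncard_powerset, Set.ncard_univ]

/-- Complete reachability, together with the uniqueness of the transformation with a given image,
amounts to minimality. -/
theorem isMinimalCRA_iff [Nonempty Q] {A : Automaton Q S} : A.IsMinimalCRA ↔
    A.CompletelyReachable ∧ ∀ f ∈ A.transitionMonoid, ∀ g ∈ A.transitionMonoid,
      Set.range f = Set.range g → f = g := by
  refine and_congr_right fun hA => ?_
  let φ : A.transitionMonoid → {P : Set Q // P.Nonempty} := fun f =>
    ⟨Set.range (f.1 : Q → Q), Set.range_nonempty _⟩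
  have hsurj : Function.Surjective φ := fun ⟨P, hP⟩ => by
    obtain ⟨w, hw⟩ := hA P hP
    exact ⟨⟨fun q => A.run q w, w, fun _ => rfl⟩, Subtype.ext hw.symm⟩
  have : Finite (Function.End Q) := inferInstanceAs (Finite (Q → Q))
  rw [syntacticComplexity, ← card_nonempty_sets]
  constructor
  · intro hc f hf g hg hfg
    have hinj := ((Nat.bijective_iff_surjective_and_card φ).2 ⟨hsurj, hc⟩).1
    exact congrArg Subtype.val (@hinj ⟨f, hf⟩ ⟨g, hg⟩ (Subtype.ext hfg))
  · intro h
    exact Nat.card_congr (Equiv.ofBijective φ ⟨fun f g hfg =>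
      Subtype.ext (h _ f.2 _ g.2 (congrArg Subtype.val hfg)), hsurj⟩)

/-- The empty automaton has one transformation, not `2 ^ 0 - 1`. -/
theorem IsMinimalCRA.nonempty {A : Automaton Q S} (hA : A.IsMinimalCRA) : Nonempty Q := by
  by_contra hQ
  rw [not_nonempty_iff] at hQ
  have h := hA.2
  rw [Nat.card_of_isEmpty, pow_zero] at h
  have : Finite (Function.End Q) := inferInstanceAs (Finite (Q → Q))
  have hpos : 0 < Nat.card A.transitionMonoid := Nat.card_pos
  exact hpos.ne' h

theorem IsMinimalCRA.minimalOn {A : Automaton Q S} (hA : A.IsMinimalCRA) :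
    MinimalOn {f : Q → Q | f ∈ A.transitionMonoid} Set.univ := by
  have := hA.nonempty
  obtain ⟨h₁, h₂⟩ := isMinimalCRA_iff.1 hA
  refine ⟨Set.univ_nonempty, fun _ _ _ _ => trivial, fun f hf g hg => ?_, fun P _ hP => ?_,
    fun f hf g hg hfg => ?_⟩
  · exact A.transitionMonoid.mul_mem hg hf
  · obtain ⟨w, hw⟩ := h₁ P hP
    exact ⟨fun q => A.run q w, ⟨w, fun _ => rfl⟩, by rw [Set.image_univ, ← hw]⟩
  · rw [Set.image_univ, Set.image_univ] at hfg
    rw [h₂ f hf g hg hfg]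
    exact fun _ _ => rfl

/-- If all letters are hierarchical for a tree, so are all elements of the transition monoid. -/
theorem hierarchical_of_mem_transitionMonoid {A : Automaton Q S} {T : LabelledTree Q}
    (hT : T.Distinct) (hTu : T.labels = Set.univ) (h : ∀ a, T.Hierarchical fun q => A.step q a)
    {f : Q → Q} (hf : f ∈ A.transitionMonoid) : T.Hierarchical f := by
  obtain ⟨w, hw⟩ := hf
  obtain rfl : f = fun q => A.run q w := funext hw
  clear hw
  induction w with
  | nil =>
    change T.Hierarchical fun q => q
    rw [Hierarchical, Set.image_id', prune_eq_self le_rfl]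
    exact Folds.id T
  | cons a w ih =>
    exact ih.comp hT (h a) (fun _ _ => hTu ▸ trivial) (fun _ _ => hTu ▸ trivial)

theorem exists_mem_range_eq {A : Automaton Q S} (hA : A.CompletelyReachable) {P : Set Q}
    (hP : P.Nonempty) : ∃ f : Q → Q, f ∈ A.transitionMonoid ∧ Set.range f = P := by
  obtain ⟨w, hw⟩ := hA P hP
  exact ⟨fun q => A.run q w, ⟨w, fun _ => rfl⟩, hw.symm⟩

theorem transitionMonoid_le_of_hierarchical {S' : Type*} [Finite S'] [Nonempty Q]
    {A : Automaton Q S} {B : Automaton Q S'} {T : LabelledTree Q} (hTu : T.labels = Set.univ)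
    (hA : ∀ f : Q → Q, f ∈ A.transitionMonoid → T.Hierarchical f)
    (hB : ∀ f : Q → Q, f ∈ B.transitionMonoid → T.Hierarchical f)
    (hBr : B.CompletelyReachable) : A.transitionMonoid ≤ B.transitionMonoid := by
  intro f hf
  obtain ⟨g, hg, h⟩ := exists_mem_range_eq hBr (Set.range_nonempty (f : Q → Q))
  have e : (f : Q → Q) = g := Hierarchical.eq hTu (hA f hf) (hB g hg) h.symm
  rw [e]; exact hg

end Automaton

/-! ### The transition monoid of the automaton of a respectful tree -/

namespace FullTree

open Vertex

theorem run_automaton {Γ : FullTree} (hΓ : Respectful Γ) {μ : Vertex Γ → NonemptyInterval ℕ}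
    (hμ : IsFaithful μ) (w : List (Letter Γ)) (q : State μ) :
    ((automaton hΓ hμ).run q w).1 = actWord μ w q.1 := by
  induction w generalizing q with
  | nil => rfl
  | cons a w ih => exact ih _

theorem completelyReachable_automaton {Γ : FullTree} (hΓ : Respectful Γ)
    {μ : Vertex Γ → NonemptyInterval ℕ} (hμ : IsFaithful μ) :
    (automaton hΓ hμ).CompletelyReachable := by
  intro P hP
  obtain ⟨w, hw⟩ := exists_actWord_image_eq hΓ hμ (P := Subtype.val '' P)
    (by rintro _ ⟨x, -, rfl⟩; exact x.2) (hP.image _)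
  refine ⟨w, Subtype.val_injective.image_injective ?_⟩
  simp only [← hw, ← Set.range_comp, Function.comp_def, run_automaton]
  ext y
  constructor
  · rintro ⟨x, hx, rfl⟩; exact ⟨⟨x, hx⟩, rfl⟩
  · rintro ⟨x, rfl⟩; exact ⟨x.1, x.2, rfl⟩

/-- Letters remain hierarchical when the states are renamed along mutually inverse folds. -/
theorem hierarchical_conj {Q : Type*} {Γ : FullTree} (hΓ : Respectful Γ)
    {μ : Vertex Γ → NonemptyInterval ℕ} (hμ : IsFaithful μ) {T : LabelledTree Q} (hT : T.Distinct)
    {φ : Q → ℕ} {ψ : ℕ → Q} (hφ : Folds φ T (Γ.toLabelled μ)) (hψ : Folds ψ (Γ.toLabelled μ) T)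
    {v : Vertex Γ} (hv : v ≠ root) : T.Hierarchical (ψ ∘ act Γ μ v ∘ φ) := by
  have hsub : act Γ μ v '' (Γ.toLabelled μ).labels ⊆ (Γ.toLabelled μ).labels := by
    rw [labels_toLabelled hμ]
    rintro _ ⟨x, hx, rfl⟩
    exact act_mem hΓ hμ v hx
  have h := (hψ.prune hT hsub ((labels_nonempty _).image _)).comp
    (Folds.comp (hierarchical_act hΓ hμ hv) hφ)
  rwa [← hφ.image, ← Set.image_comp, ← Set.image_comp] at h

theorem hierarchical_of_mem_rename {Q : Type u} [Finite Q] {Γ : FullTree} (hΓ : Respectful Γ)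
    {μ : Vertex Γ → NonemptyInterval ℕ} (hμ : IsFaithful μ) {T : LabelledTree Q} (hT : T.Distinct)
    (hTu : T.labels = Set.univ) {e : Q ≃ State μ} {ψ : ℕ → Q}
    (hφ : Folds (fun q => (e q).1) T (Γ.toLabelled μ)) (hψ : Folds ψ (Γ.toLabelled μ) T)
    (he : ∀ x : State μ, ψ x.1 = e.symm x) {f : Q → Q}
    (hf : f ∈ ((automaton hΓ hμ).rename e).transitionMonoid) : T.Hierarchical f := by
  refine Automaton.hierarchical_of_mem_transitionMonoid hT hTu (fun a => ?_) hf
  have h := hierarchical_conj hΓ hμ hT hφ hψ a.2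
  have : (ψ ∘ act Γ μ a.1 ∘ fun q => (e q).1) =
      fun q => ((automaton hΓ hμ).rename e).step q a := by
    funext q
    exact he ⟨act Γ μ a.1 (e q), _⟩
  rwa [this] at h

end FullTree

theorem Automaton.run_rename {Q R : Type*} {S : Type*} [Finite Q] [Finite R] [Finite S]
    (B : Automaton R S) (e : Q ≃ R) (q : Q) (w : List S) :
    (B.rename e).run q w = e.symm (B.run (e q) w) := by
  induction w generalizing q with
  | nil => exact (e.symm_apply_apply q).symm
  | cons a w ih =>
    change (B.rename e).run ((B.rename e).step q a) w = e.symm (B.run (B.step (e q) a) w)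
    rw [ih, rename, e.apply_symm_apply]

theorem Automaton.CompletelyReachable.rename {Q R : Type*} {S : Type*} [Finite Q] [Finite R]
    [Finite S] {B : Automaton R S} (h : B.CompletelyReachable) (e : Q ≃ R) :
    (B.rename e).CompletelyReachable := by
  intro P hP
  obtain ⟨w, hw⟩ := h (e '' P) (hP.image e)
  refine ⟨w, e.injective.image_injective ?_⟩
  simp only [hw, ← Set.range_comp, Function.comp_def, run_rename, e.apply_symm_apply]
  exact (e.surjective.range_comp fun q => B.run q w).symm

namespace FullTree

/-- A tree with distinct labels and the shape of `Γ` yields a bijective renaming of the states. -/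
theorem exists_equiv_state {Q : Type u} {Γ : FullTree} {μ : Vertex Γ → NonemptyInterval ℕ}
    (hμ : IsFaithful μ) {T : LabelledTree Q} (hT : T.Distinct) (hTu : T.labels = Set.univ)
    (hs : T.shape = Γ) : ∃ (e : Q ≃ State μ) (ψ : ℕ → Q),
      Folds (fun q => (e q).1) T (Γ.toLabelled μ) ∧ Folds ψ (Γ.toLabelled μ) T ∧
      ∀ x : State μ, ψ x.1 = e.symm x := by
  obtain ⟨φ, hφ⟩ := exists_folds_of_shape_eq (U := Γ.toLabelled μ) hT (by rw [shape_toLabelled, hs])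
  obtain ⟨ψ, hψ⟩ := exists_folds_of_shape_eq (U := T) (distinct_toLabelled hμ)
    (by rw [shape_toLabelled, hs])
  have h₁ := (hψ.comp hφ).eqOn_id
  have h₂ := (hφ.comp hψ).eqOn_id
  refine ⟨⟨fun q => ⟨φ q, ?_⟩, fun x => ψ x.1, fun q => h₁ (hTu ▸ trivial),
    fun x => Subtype.ext (h₂ ((mem_labels_toLabelled hμ).2 x.2))⟩, ψ, hφ, hψ, fun _ => rfl⟩
  rw [← mem_labels_toLabelled hμ, ← hφ.image]
  exact Set.mem_image_of_mem φ (hTu ▸ trivial)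

end FullTree

/-! ### Renaming the labels -/

namespace LabelledTree

variable {α : Type*}

/-- The image of a labelled tree under a renaming of the labels. -/
def map {β : Type*} (f : α → β) : LabelledTree α → LabelledTree β
  | leaf x => leaf (f x)
  | node l r => node (l.map f) (r.map f)

theorem folds_map {β : Type*} (f : α → β) (T : LabelledTree α) : Folds f T (T.map f) := by
  induction T with
  | leaf x => rintro _ rfl; rfl
  | node l r hl hr => exact ⟨hl, hr⟩

@[simp] theorem shape_map {β : Type*} (f : α → β) (T : LabelledTree α) :
    (T.map f).shape = T.shape := by
  induction T with
  | leaf x => rfl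
  | node l r hl hr => simp [map, shape, hl, hr]

theorem Distinct.map {β : Type*} {f : α → β} {T : LabelledTree α} (hT : T.Distinct)
    (hf : Set.InjOn f T.labels) : (T.map f).Distinct := by
  induction T with
  | leaf x => trivial
  | node l r hl hr =>
    refine ⟨?_, hl hT.2.1 (hf.mono Set.subset_union_left),
      hr hT.2.2 (hf.mono Set.subset_union_right)⟩
    rw [← (folds_map f l).image, ← (folds_map f r).image]
    rw [Set.disjoint_left]
    rintro _ ⟨x, hx, rfl⟩ ⟨y, hy, e⟩
    obtain rfl := hf (.inr hy) (.inl hx) e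
    exact Set.disjoint_left.1 hT.1 hx hy

/-! ### Counting letters -/

/-- The sets of leaves below the vertices of a tree. -/
def blocks : LabelledTree α → Set (Set α)
  | leaf x => {{x}}
  | node l r => insert (l.labels ∪ r.labels) (l.blocks ∪ r.blocks)

theorem block_subset {T : LabelledTree α} {B : Set α} (hB : B ∈ T.blocks) : B ⊆ T.labels := by
  induction T with
  | leaf x => exact (Set.mem_singleton_iff.1 hB).le
  | node l r hl hr =>
    rcases hB with rfl | hB | hB
    · exact le_rfl
    · exact (hl hB).trans Set.subset_union_left
    · exact (hr hB).trans Set.subset_union_right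

theorem block_nonempty {T : LabelledTree α} {B : Set α} (hB : B ∈ T.blocks) : B.Nonempty := by
  induction T with
  | leaf x => rw [Set.mem_singleton_iff.1 hB]; exact Set.singleton_nonempty x
  | node l r hl hr =>
    rcases hB with rfl | hB | hB
    · exact l.labels_nonempty.mono Set.subset_union_left
    · exact hl hB
    · exact hr hB

theorem labels_mem_blocks (T : LabelledTree α) : T.labels ∈ T.blocks := by
  cases T with
  | leaf x => exact rfl
  | node l r => exact Set.mem_insert _ _

theorem finite_blocks (T : LabelledTree α) : T.blocks.Finite := by
  induction T with
  | leaf x => exact Set.finite_singleton _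
  | node l r hl hr => exact (hl.union hr).insert _

/-- A full binary tree with `n` leaves has `2 n - 1` vertices. -/
theorem ncard_blocks {T : LabelledTree α} (hT : T.Distinct) :
    T.blocks.ncard + 1 = 2 * T.labels.ncard := by
  induction T with
  | leaf x => simp [blocks, labels]
  | node l r hl hr =>
    have h₁ := hl hT.2.1
    have h₂ := hr hT.2.2
    have hd := Set.disjoint_left.1 hT.1
    have hdis : Disjoint l.blocks r.blocks := by
      rw [Set.disjoint_left]
      intro B hB hB'
      obtain ⟨x, hx⟩ := block_nonempty hB
      exact hd (block_subset hB hx) (block_subset hB' hx)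
    have hnot : l.labels ∪ r.labels ∉ l.blocks ∪ r.blocks := by
      rintro (h | h)
      · obtain ⟨x, hx⟩ := r.labels_nonempty
        exact hd (block_subset h (.inr hx)) hx
      · obtain ⟨x, hx⟩ := l.labels_nonempty
        exact hd hx (block_subset h (.inl hx))
    rw [blocks, labels, Set.ncard_insert_of_notMem hnot (l.finite_blocks.union r.finite_blocks),
      Set.ncard_union_eq hdis l.finite_blocks r.finite_blocks,
      Set.ncard_union_eq hT.1 l.finite_labels r.finite_labels]
    omega

/-- A fold whose image contains all leaves outside a block `B` and some leaf of `B` fixes the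
leaves outside `B` and preserves `B`. -/
theorem Folds.block {T : LabelledTree α} {f : α → α} {B R : Set α} (hB : B ∈ T.blocks)
    (hf : Folds f T (T.prune R)) (hR : T.labels \ B ⊆ R) (hne : (B ∩ R).Nonempty)
    (hT : T.Distinct) : (∀ x ∈ T.labels \ B, f x = x) ∧ ∀ x ∈ B, f x ∈ B := by
  have whole : ∀ {T : LabelledTree α}, Folds f T (T.prune R) → (T.labels ∩ R).Nonempty →
      (∀ x ∈ T.labels \ T.labels, f x = x) ∧ ∀ x ∈ T.labels, f x ∈ T.labels := by
    intro T hf hne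
    refine ⟨fun x hx => (hx.2 hx.1).elim, fun x hx => ?_⟩
    have := hf.image.subset (Set.mem_image_of_mem f hx)
    rw [labels_prune hne] at this
    exact this.1
  induction T with
  | leaf x =>
    obtain rfl : B = (leaf x).labels := hB
    exact whole hf hne
  | node l r hl hr =>
    rcases hB with rfl | hB | hB
    · exact whole (T := node l r) hf hne
    · have hBl := block_subset hB
      have hrR : r.labels ⊆ R := fun x hx =>
        hR ⟨.inr hx, fun hxB => Set.disjoint_left.1 hT.1 (hBl hxB) hx⟩
      rw [prune_node (hne.mono (Set.inter_subset_inter_left _ hBl))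
        (by rw [Set.inter_eq_left.2 hrR]; exact r.labels_nonempty), prune_eq_self hrR] at hf
      obtain ⟨h₁, h₂⟩ := hl hB hf.1 (fun x hx => hR ⟨.inl hx.1, hx.2⟩) hT.2.1
      refine ⟨?_, h₂⟩
      rintro x ⟨hx | hx, hxB⟩
      exacts [h₁ x ⟨hx, hxB⟩, hf.2.eqOn_id hx]
    · have hBr := block_subset hB
      have hlR : l.labels ⊆ R := fun x hx =>
        hR ⟨.inl hx, fun hxB => Set.disjoint_left.1 hT.1 hx (hBr hxB)⟩
      rw [prune_node (by rw [Set.inter_eq_left.2 hlR]; exact l.labels_nonempty)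
        (hne.mono (Set.inter_subset_inter_left _ hBr)), prune_eq_self hlR] at hf
      obtain ⟨h₁, h₂⟩ := hr hB hf.2 (fun x hx => hR ⟨.inr hx.1, hx.2⟩) hT.2.2
      refine ⟨?_, h₂⟩
      rintro x ⟨hx | hx, hxB⟩
      exacts [hf.1.eqOn_id hx, h₁ x ⟨hx, hxB⟩]

end LabelledTree

namespace Automaton

variable {Q : Type u} {S : Type v} [Finite Q] [Finite S]

/-- The complement of a block of the tree is the image of a letter: a product of transformations
has this image only if one of the factors has. -/
theorem exists_letter_range_eq {A : Automaton Q S} {T : LabelledTree Q} (hT : T.Distinct)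
    (hTu : T.labels = Set.univ) (hA : ∀ f : Q → Q, f ∈ A.transitionMonoid → T.Hierarchical f)
    {B : Set Q} (hB : B ∈ T.blocks) {w : List S} (hw : Set.range (fun q => A.run q w) = Bᶜ) :
    ∃ a, Set.range (fun q => A.step q a) = Bᶜ := by
  induction w using List.reverseRecOn with
  | nil =>
    obtain ⟨x, hx⟩ := LabelledTree.block_nonempty hB
    exact (hw.subset ⟨x, rfl⟩ hx).elim
  | append_singleton w a ih =>
    have hrun : ∀ q, A.run q (w ++ [a]) = A.step (A.run q w) a := fun q => A.run_append q w [a]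
    simp only [hrun] at hw
    have hsub : Bᶜ ⊆ Set.range fun q => A.step q a := by
      rw [← hw]; rintro _ ⟨q, rfl⟩; exact ⟨_, rfl⟩
    -- If the last letter reaches `B`, it acts as the identity on the image of the rest of the word.
    by_cases hne : (B ∩ Set.range fun q => A.step q a).Nonempty
    · have hh := hA (fun q => A.step q a) ⟨[a], fun _ => rfl⟩
      rw [Hierarchical, hTu, Set.image_univ] at hh
      obtain ⟨h₁, h₂⟩ := hh.block hB (fun x hx => hsub hx.2) hne hT
      have hfix : ∀ q, A.run q w ∉ B := fun q hq => hw.subset ⟨q, rfl⟩ (h₂ _ hq)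
      have hstep : ∀ q, A.step (A.run q w) a = A.run q w := fun q =>
        h₁ _ ⟨hTu ▸ trivial, hfix q⟩
      simp only [hstep] at hw
      exact ih hw
    · refine ⟨a, Set.Subset.antisymm (fun x hx hxB => hne ⟨x, hxB, hx⟩) hsub⟩

/-- Distinct proper blocks require distinct letters. -/
theorem two_mul_card_le_card_letters {A : Automaton Q S} (hA : A.CompletelyReachable)
    {T : LabelledTree Q} (hT : T.Distinct) (hTu : T.labels = Set.univ)
    (h : ∀ f : Q → Q, f ∈ A.transitionMonoid → T.Hierarchical f) :
    2 * Nat.card Q - 2 ≤ Nat.card S := by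
  have key : ∀ B : ↥(T.blocks \ {Set.univ}), ∃ a, Set.range (fun q => A.step q a) = B.1ᶜ := by
    rintro ⟨B, hB, hBu⟩
    obtain ⟨w, hw⟩ := hA Bᶜ (Set.nonempty_compl.2 hBu)
    exact exists_letter_range_eq hT hTu h hB hw.symm
  choose φ hφ using key
  have hinj : Function.Injective φ := fun B C hBC => by
    have := (hφ B).symm.trans (hBC ▸ hφ C)
    exact Subtype.ext (compl_injective this)
  have hle := Nat.card_le_card_of_injective φ hinj
  have hc := ncard_blocks hT
  rw [hTu, Set.ncard_univ] at hc
  rw [Nat.card_coe_set_eq, Set.ncard_sdiff_singleton_of_mem (hTu ▸ T.labels_mem_blocks)] at hle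
  omega

end Automaton

/-! ### The classification -/

theorem FullTree.isMinimalCRA_automaton {Γ : FullTree} (hΓ : Respectful Γ)
    {μ : Vertex Γ → NonemptyInterval ℕ} (hμ : IsFaithful μ) :
    (automaton hΓ hμ).IsMinimalCRA := by
  classical
  have hfst : (μ .root).fst ∈ μ .root := ⟨le_rfl, (μ .root).fst_le_snd⟩
  let ψ : ℕ → State μ := fun x => if h : x ∈ μ .root then ⟨x, h⟩ else ⟨_, hfst⟩
  have : Nonempty (State μ) := ⟨⟨_, hfst⟩⟩
  have hψ : ∀ x : State μ, ψ x.1 = x := fun x => dif_pos x.2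
  let T := (Γ.toLabelled μ).map ψ
  have hfold : Folds ψ (Γ.toLabelled μ) T := folds_map ψ _
  have hT : T.Distinct := (distinct_toLabelled hμ).map fun x hx y hy hxy => by
    rw [mem_labels_toLabelled hμ] at hx hy
    rw [show ψ x = ⟨x, hx⟩ from hψ ⟨x, hx⟩, show ψ y = ⟨y, hy⟩ from hψ ⟨y, hy⟩] at hxy
    exact congrArg Subtype.val hxy
  have hTu : T.labels = Set.univ := by
    rw [← hfold.image]
    exact Set.eq_univ_of_forall fun x => ⟨x.1, (mem_labels_toLabelled hμ).2 x.2, hψ x⟩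
  have hval : Folds (fun q : State μ => q.1) T (Γ.toLabelled μ) := by
    obtain ⟨φ, hφ⟩ := exists_folds_of_shape_eq (U := Γ.toLabelled μ) hT (shape_map ψ _)
    refine hφ.congr fun x _ => ?_
    have := (hφ.comp hfold).eqOn_id ((mem_labels_toLabelled hμ).2 x.2)
    rwa [Function.comp, hψ] at this
  have hr := completelyReachable_automaton hΓ hμ
  refine Automaton.isMinimalCRA_iff.2 ⟨hr, fun f hf g hg hfg => ?_⟩
  have key : ∀ f : State μ → State μ, f ∈ (automaton hΓ hμ).transitionMonoid →
      T.Hierarchical f := fun f hf =>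
    hierarchical_of_mem_rename hΓ hμ hT hTu (e := Equiv.refl _) hval hfold hψ hf
  exact Hierarchical.eq hTu (key f hf) (key g hg) hfg

theorem Automaton.IsMinimalCRA.exists_labelledTree {Q : Type u} {S : Type v} [Finite Q] [Finite S]
    {A : Automaton Q S} (hA : A.IsMinimalCRA) : ∃ T : LabelledTree Q, T.Distinct ∧
      T.labels = Set.univ ∧ ∀ f : Q → Q, f ∈ A.transitionMonoid → T.Hierarchical f :=
  hA.minimalOn.exists_labelledTree Set.finite_univ

theorem Automaton.IsMinimalCRA.exists_respectful {Q : Type u} {S : Type v} [Finite Q] [Finite S]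
    {A : Automaton Q S} (hA : A.IsMinimalCRA) :
    ∃ (Γ : FullTree) (hΓ : Γ.Respectful) (μ : Γ.Vertex → NonemptyInterval ℕ)
      (hμ : FullTree.IsFaithful μ) (e : Q ≃ FullTree.State μ),
      A.SyntacticallyEquivalent ((FullTree.automaton hΓ hμ).rename e) := by
  have := hA.nonempty
  obtain ⟨T, hT, hTu, h⟩ := hA.exists_labelledTree
  have hΓ : T.shape.Respectful := FullTree.respectful_of_folds hT fun P _ hP => by
    obtain ⟨f, hf, hfP⟩ := exists_mem_range_eq hA.1 hP
    have hh := h f hf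
    rw [Hierarchical, hTu, Set.image_univ, hfP] at hh
    exact ⟨f, hh⟩
  have hμ := FullTree.isFaithful_marking T.shape le_rfl
  obtain ⟨e, ψ, hφ, hψ, he⟩ := FullTree.exists_equiv_state hμ hT hTu rfl
  refine ⟨T.shape, hΓ, _, hμ, e, ?_⟩
  have h' : ∀ f : Q → Q, f ∈ ((FullTree.automaton hΓ hμ).rename e).transitionMonoid →
      T.Hierarchical f := fun f hf =>
    FullTree.hierarchical_of_mem_rename hΓ hμ hT hTu hφ hψ he hf
  have hr := (FullTree.completelyReachable_automaton hΓ hμ).rename e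
  exact le_antisymm (transitionMonoid_le_of_hierarchical hTu h h' hr)
    (transitionMonoid_le_of_hierarchical hTu h' h hA.1)

theorem theorem3 :
    -- for every respectful tree and every faithful marking, the automaton is minimal
    (∀ (Γ : FullTree) (hΓ : Γ.Respectful) (μ : Γ.Vertex → NonemptyInterval ℕ)
      (hμ : FullTree.IsFaithful μ), (FullTree.automaton hΓ hμ).IsMinimalCRA) ∧
    -- every minimal automaton is, up to renaming of states, syntactically equivalent to one of these
    (∀ (Q : Type u) (S : Type v) [Finite Q] [Finite S] (A : Automaton Q S), A.IsMinimalCRA →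
      ∃ (Γ : FullTree) (hΓ : Γ.Respectful) (μ : Γ.Vertex → NonemptyInterval ℕ)
        (hμ : FullTree.IsFaithful μ) (e : Q ≃ FullTree.State μ),
        A.SyntacticallyEquivalent ((FullTree.automaton hΓ hμ).rename e)) ∧
    -- the number of input letters
    (∀ (Q : Type u) (S : Type v) [Finite Q] [Finite S] (A : Automaton Q S), A.IsMinimalCRA →
      2 * Nat.card Q - 2 ≤ Nat.card S) := by
  refine ⟨fun Γ hΓ μ hμ => FullTree.isMinimalCRA_automaton hΓ hμ,
    fun Q S _ _ A hA => hA.exists_respectful, fun Q S _ _ A hA => ?_⟩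
  obtain ⟨T, hT, hTu, h⟩ := hA.exists_labelledTree
  exact Automaton.two_mul_card_le_card_letters hA.1 hT hTu h
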